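/- Let $G$ be a locally compact, second-countable, amenable group and let $\Gamma$ be a countable dense subgroup of $G$. A system is a jointly measurable, measure-preserving action $T$ of $G$ on a countably generated probability space whose measurable sets separate points. Let $\mathbf{X}=(X,\mathscr{B},\mu,T)$ be a system that is an extension of a system $\mathbf{Y}=(Y,\mathscr{D},\nu,S)$, i.e. there is a measurable, measure-preserving map $\pi:X\to Y$ with $\pi(T^g x)=S^g\pi(x)$ for all $g\in G$, $x\in X$. All function spaces are real; write $(T^g f)(x)=f(T^g x)$, and regard $L^2(\mathbf{X})$ as an $L^\infty(\mathbf{Y})$-module via $(\alpha f)(x)=\alpha(\pi x)f(x)$. For $h\in L^2(\mathbf{X})$ let $\|h\|_y=\mathbb{E}(h^2\mid\mathbf{Y})(y)^{1/2}$, defined for almost every $y \in Y$. A function $f\in L^2(\mathbf{X})$ is almost-periodic over $\mathbf{Y}$ if for every $\epsilon>0$ there are a finite set $\Xi\subset L^\infty(\mathbf{X})$ and a measurable set $E\subset Y$ with $\nu(E)>1-\epsilon$ such that $\min\{\|T^\gamma f-\xi\|_y:\xi\in\Xi\}\le\epsilon$ for each $\gamma\in\Gamma$ and almost every $y\in E$.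 Let $\mathcal{A}(\mathbf{X}|\mathbf{Y})$ be the closure in $L^2(\mathbf{X})$ of the set of functions that are almost-periodic over $\mathbf{Y}$. A function $f\in L^2(\mathbf{X})$ is an eigenfunction over $\mathbf{Y}$ if the closed $L^\infty(\mathbf{Y})$-submodule $\mathscr{M}$ of $L^2(\mathbf{X})$ spanned by the orbit $\{T^g f:g\in G\}$ has finite rank, i.e. there are $d \ge 0$ and $\phi_1,\dots,\phi_d\in L^2(\mathbf{X})$ such that $\{\alpha^1\phi_1+\dots+\alpha^d\phi_d:\alpha^1,\dots,\alpha^d\in L^\infty(\mathbf{Y})\}$ is a dense subset of $\mathscr{M}$. Let $\mathrm{Eig}(\mathbf{X}|\mathbf{Y})$ be the closed linear subspace of $L^2(\mathbf{X})$ spanned by the eigenfunctions over $\mathbf{Y}$. Then $$\mathcal{A}(\mathbf{X}|\mathbf{Y})=\mathrm{Eig}(\mathbf{X}|\mathbf{Y}).$$ Moreover, the same equality holds when $\|\cdot\|_y$ is replaced, in the definition of almost-periodicity, by the norm of $L^2(X,\mathscr{B},\mu_y)$ for any disintegration $(\mu_y)_{y\in Y}$ of $\mu$ over $\mathbf{Y}$,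 that is, any almost surely defined family of probability measures on $(X,\mathscr{B})$ such that, for every square-integrable measurable $f : X \to \mathbb{R}$ and every $g\in G$, the map $y\mapsto\int f\,d\mu_y$ is almost surely defined and measurable, $\int f\,d\mu_y=\mathbb{E}(f\mid\mathbf{Y})(y)$ and $\int T^g f\,d\mu_y=\int f\,d\mu_{S^g y}$ for almost every $y$. -/

import Mathlib

open MeasureTheory Filter Topology
open scoped ENNReal BoundedContinuousFunction

noncomputable section

namespace RelErgodic

/-- A topological group `G` is amenable if there is a left-invariant mean on the bounded
continuous functions on `G`. -/
def IsAmenable (G : Type*) [Group G] [TopologicalSpace G] [IsTopologicalGroup G] : Prop :=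
  ∃ m : (G →ᵇ ℝ) →ₗ[ℝ] ℝ,
    (∀ φ : G →ᵇ ℝ, (∀ x, 0 ≤ φ x) → 0 ≤ m φ) ∧
    m (BoundedContinuousFunction.const G 1) = 1 ∧
    ∀ (g : G) (φ : G →ᵇ ℝ), m (φ.compContinuous (ContinuousMap.mulLeft g)) = m φ

/-- A `G`-system: a jointly measurable, measure-preserving action of `G` on a countably generated
probability space whose measurable sets separate points. -/
class IsSystem (G : Type*) [Group G] [MeasurableSpace G]
    (X : Type*) [MeasurableSpace X] [MulAction G X] (μ : Measure X) : Prop where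
  countablyGenerated : MeasurableSpace.CountablyGenerated X
  separatesPoints : MeasurableSpace.SeparatesPoints X
  isProbabilityMeasure : IsProbabilityMeasure μ
  measurable_action : Measurable fun p : G × X => p.1 • p.2
  measurePreserving (g : G) : MeasurePreserving (fun x : X => g • x) μ μ

/-- `π` is a factor map from the system on `(X, μ)` to the system on `(Y, ν)`. -/
structure IsFactorMap (G : Type*) [Group G]
    {X : Type*} [MeasurableSpace X] [MulAction G X] (μ : Measure X)
    {Y : Type*} [MeasurableSpace Y] [MulAction G Y] (ν : Measure Y) (π : X → Y) : Prop where
  measurePreserving : MeasurePreserving π μ ν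
  equivariant (g : G) (x : X) : π (g • x) = g • π x

section

variable {G : Type*} [Group G] [MeasurableSpace G]
  {X : Type*} [MeasurableSpace X] [MulAction G X]
  {Y : Type*} [MeasurableSpace Y] [MulAction G Y]

/-- The operator `(T^g f)(x) = f (T^g x)` on `L²(X)`. -/
def koopman (μ : Measure X) [IsSystem G X μ] (g : G) (f : Lp ℝ 2 μ) : Lp ℝ 2 μ :=
  Lp.compMeasurePreserving (fun x : X => g • x) (IsSystem.measurePreserving g) f

/-- `(μ_y)` is an almost surely defined disintegration of `μ` over the factor `π : X → Y`. -/
structure IsDisintegration (G : Type*) [Group G] [MulAction G X] [MulAction G Y]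
    (μ : Measure X) (ν : Measure Y) (π : X → Y) (μy : Y → Measure X) : Prop where
  isProbabilityMeasure : ∀ᵐ y ∂ν, IsProbabilityMeasure (μy y)
  integrable (f : X → ℝ) : Measurable f → MemLp f 2 μ → ∀ᵐ y ∂ν, Integrable f (μy y)
  aemeasurable (f : X → ℝ) : Measurable f → MemLp f 2 μ →
    AEMeasurable (fun y => ∫ x, f x ∂(μy y)) ν
  condExp_eq (f : X → ℝ) : Measurable f → MemLp f 2 μ →
    μ[f | MeasurableSpace.comap π inferInstance] =ᵐ[μ] fun x => ∫ x', f x' ∂(μy (π x))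
  equivariant (g : G) (f : X → ℝ) : Measurable f → MemLp f 2 μ →
    ∀ᵐ y ∂ν, ∫ x, f (g • x) ∂(μy y) = ∫ x, f x ∂(μy (g • y))

/-- The norm `‖h‖_y` at `y = π x`, as a function of `x`, for a given family `(μ_y)`:
the norm of `h` in `L²(X, μ_y)`. -/
def fiberNorm (μ : Measure X) (π : X → Y) (μy : Y → Measure X) (h : Lp ℝ 2 μ) (x : X) : ℝ :=
  √(∫ x', (h x') ^ 2 ∂(μy (π x)))

/-- The norm `‖h‖_y` at `y = π x`, as a function of `x`, through conditional expectation: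
`‖h‖_y² = E(h² | Y)(y)`. It needs no disintegration; it agrees almost everywhere with `fiberNorm`
for any disintegration. -/
def condFiberNorm (μ : Measure X) (π : X → Y) (h : Lp ℝ 2 μ) (x : X) : ℝ :=
  √((μ[fun x' => (h x') ^ 2 | MeasurableSpace.comap π inferInstance]) x)

/-- `f ∈ L²(X)` is almost periodic over `Y`, for the fibre norms `‖h‖_{π x} = N h x`. Since `π` is
measure preserving, "for almost every `y ∈ E`" is expressed as "for almost every `x ∈ π⁻¹ E`". -/
def IsAlmostPeriodic (Γ : Subgroup G) (μ : Measure X) [IsSystem G X μ] (ν : Measure Y) (π : X → Y)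
    (N : Lp ℝ 2 μ → X → ℝ) (f : Lp ℝ 2 μ) : Prop :=
  ∀ ε : ℝ, 0 < ε →
    ∃ Ξ : Finset (Lp ℝ 2 μ), (∀ ξ ∈ Ξ, MemLp ξ ∞ μ) ∧
      ∃ E : Set Y, MeasurableSet E ∧ 1 - ε < ν.real E ∧
        ∀ γ ∈ Γ, ∀ᵐ x ∂μ, π x ∈ E → ∃ ξ ∈ Ξ, N (koopman μ γ f - ξ) x ≤ ε

/-- `A(X|Y)`: the closure in `L²(X)` of the set of almost periodic functions over `Y`. -/
def almostPeriodic (Γ : Subgroup G) (μ : Measure X) [IsSystem G X μ] (ν : Measure Y) (π : X → Y)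
    (N : Lp ℝ 2 μ → X → ℝ) : Set (Lp ℝ 2 μ) :=
  closure {f | IsAlmostPeriodic Γ μ ν π N f}

end

section

variable {X : Type*} [MeasurableSpace X] {Y : Type*} [MeasurableSpace Y]

/-- The `L^∞(Y)`-submodule of `L²(X)` generated by `S`, i.e. the set of finite sums of functions
`(α ∘ π) s` with `α ∈ L^∞(Y)` and `s ∈ S`. -/
def moduleSpan (μ : Measure X) (ν : Measure Y) (π : X → Y) (S : Set (Lp ℝ 2 μ)) :
    Submodule ℝ (Lp ℝ 2 μ) :=
  Submodule.span ℝ {h | ∃ α : Y → ℝ, MemLp α ∞ ν ∧ ∃ s ∈ S, h =ᵐ[μ] fun x => α (π x) * s x}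

/-- The set `{α¹ φ₁ + ⋯ + αᵈ φ_d : α¹, …, αᵈ ∈ L^∞(Y)}` in `L²(X)`. -/
def combinations (μ : Measure X) (ν : Measure Y) (π : X → Y) {d : ℕ} (φ : Fin d → Lp ℝ 2 μ) :
    Set (Lp ℝ 2 μ) :=
  {h | ∃ α : Fin d → Y → ℝ, (∀ i, MemLp (α i) ∞ ν) ∧ h =ᵐ[μ] fun x => ∑ i, α i (π x) * φ i x}

end

section

variable (G : Type*) [Group G] [MeasurableSpace G]
  {X : Type*} [MeasurableSpace X] [MulAction G X]
  {Y : Type*} [MeasurableSpace Y]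

/-- `f ∈ L²(X)` is an eigenfunction over `Y`: the closed `L^∞(Y)`-submodule `M` of `L²(X)` spanned
by the orbit of `f` has finite rank, i.e. for some `φ₁, …, φ_d` in `L²(X)` the set
`{α¹ φ₁ + ⋯ + αᵈ φ_d}` is contained in `M` and dense in it. -/
def IsEigenfunction (μ : Measure X) [IsSystem G X μ] (ν : Measure Y) (π : X → Y)
    (f : Lp ℝ 2 μ) : Prop :=
  ∃ (d : ℕ) (φ : Fin d → Lp ℝ 2 μ),
    closure (combinations μ ν π φ) =
      closure (moduleSpan μ ν π (Set.range fun g : G => koopman μ g f) : Set (Lp ℝ 2 μ))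

/-- `Eig(X|Y)`: the closed linear subspace of `L²(X)` spanned by the eigenfunctions over `Y`. -/
def eigenspan (μ : Measure X) [IsSystem G X μ] (ν : Measure Y) (π : X → Y) :
    Submodule ℝ (Lp ℝ 2 μ) :=
  (Submodule.span ℝ {f | IsEigenfunction G μ ν π f}).topologicalClosure

end

end RelErgodic

end

/-!
The space `L²(μ)` is a Hilbert module over the algebra of functions measurable over the factor,
that is, over `m = π⁻¹(Y)`: its inner product is `cip u v = E(u v | m)`. It satisfies
Cauchy–Schwarz, functions measurable over `m` can be pulled out of it, and orthogonality to a
closed submodule is orthogonality in almost every fibre. This replaces a disintegration of `μ`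
throughout.

*Eigenfunctions are limits of almost periodic functions.* The module generated by the orbit of an
eigenfunction `f` is spanned by a finite relatively orthonormal family `ψ` (relative Gram–Schmidt,
`exists_isRelOrthonormal`). Restricted to the `m`-measurable set where its fibre norm is at most
`R`, the function `f` has an orbit with uniformly bounded coefficients with respect to `ψ`, so that
a finite net of coefficients, together with bounded approximations of `ψ`, shows that it is almost
periodic (`isAlmostPeriodic_of_bounded`).

*Almost periodic functions are limits of sums of eigenfunctions.* Call a closed invariant module
finite if its fibres have bounded dimension. Every element of such a module is an eigenfunction,
because closed submodules of it are finitely generated (`IsRelModule.exists_generators`). Let `h`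
be orthogonal to all finite modules and have bounded fibre norms. Averaging
`⟨E(h T^g u | m), E(h T^g v | m)⟩` over `G` with an invariant mean gives a positive operator `K` which commutes with the
action and with multiplication by functions measurable over `m`; the Koopman representation is
continuous (`continuous_koopman`), so that the mean can be applied. For `c > 0` let `P` be twice
the positive part of `K - c`. On the closure of its range `K` is at least `c`, and Bessel's
inequality bounds the trace of `K`, so that this module is finite. As `h` is orthogonal to it, `K`
vanishes on it, hence `P = 0` and `K ≤ c`. Therefore `K = 0` (`mean_orbitForm_eq_zero`). Only the
existence of `|A| = √(A²)` for a self-adjoint operator `A` on a real Hilbert space is needed for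
this; it is obtained from the power series of `√(1 - x)`.

Now if `f` is almost periodic then at every `g` its translates are near a finite set `Ξ` in most
fibres, while for some `g` in the dense subgroup all coefficients `E(h T^g ξ | m)` with `ξ ∈ Ξ` are
small. Hence `f` is orthogonal to `h` (`IsAlmostPeriodic.inner_eq_zero`). Truncation removes the
bound on the fibre norms of `h`, and `f` lies in the closed span of the eigenfunctions.
-/

namespace RelErgodic

/-! ### Square roots of squares of self-adjoint operators -/

/-- The coefficients of the power series `1 - √(1 - x) = ∑ cₙ xⁿ⁺¹`. -/
noncomputable def sqrtCoeff (n : ℕ) : ℝ := catalan n / (2 * 4 ^ n)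

lemma sqrtCoeff_nonneg (n : ℕ) : 0 ≤ sqrtCoeff n := by unfold sqrtCoeff; positivity

/-- The recursion expressing that `y = ∑ cₙ xⁿ⁺¹` solves `y = (x + y²) / 2`. -/
lemma sqrtCoeff_succ (n : ℕ) : sqrtCoeff (n + 1) =
    (∑ p ∈ Finset.HasAntidiagonal.antidiagonal n, sqrtCoeff p.1 * sqrtCoeff p.2) / 2 := by
  have h : ∀ p ∈ Finset.HasAntidiagonal.antidiagonal n, sqrtCoeff p.1 * sqrtCoeff p.2 =
      (catalan p.1 * catalan p.2 : ℝ) / (4 * 4 ^ n) := by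
    intro p hp
    rw [← Finset.HasAntidiagonal.mem_antidiagonal.1 hp, sqrtCoeff, sqrtCoeff, pow_add]
    field_simp
    ring
  rw [Finset.sum_congr rfl h, ← Finset.sum_div, sqrtCoeff, catalan_succ']
  push_cast
  rw [pow_succ]
  field_simp

lemma sum_sqrtCoeff_le (n : ℕ) : ∑ i ∈ Finset.range n, sqrtCoeff i ≤ 1 := by
  induction n with
  | zero => simp
  | succ n ih =>
    rw [Finset.sum_range_succ']
    have h1 : ∑ k ∈ Finset.range n, sqrtCoeff (k + 1) ≤
        (∑ i ∈ Finset.range n, sqrtCoeff i) ^ 2 / 2 := by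
      simp_rw [sqrtCoeff_succ]
      rw [← Finset.sum_div, pow_two, Finset.sum_mul_sum, ← Finset.sum_product',
        ← Finset.sum_biUnion]
      · gcongr
        · exact fun i _ _ => mul_nonneg (sqrtCoeff_nonneg _) (sqrtCoeff_nonneg _)
        · intro p hp
          simp only [Finset.mem_biUnion, Finset.mem_range,
            Finset.HasAntidiagonal.mem_antidiagonal, Finset.mem_product] at hp ⊢
          omega
      · exact fun a _ b _ hab => Finset.disjoint_left.2 fun p h1 h2 => hab <|
          (Finset.HasAntidiagonal.mem_antidiagonal.1 h1).symm.trans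
            (Finset.HasAntidiagonal.mem_antidiagonal.1 h2)
    have h0 : 0 ≤ ∑ i ∈ Finset.range n, sqrtCoeff i :=
      Finset.sum_nonneg fun i _ => sqrtCoeff_nonneg i
    have h2 : sqrtCoeff 0 = 1 / 2 := by simp [sqrtCoeff]
    nlinarith

lemma summable_sqrtCoeff : Summable sqrtCoeff :=
  summable_of_sum_range_le sqrtCoeff_nonneg sum_sqrtCoeff_le

lemma tsum_sqrtCoeff_le : ∑' n, sqrtCoeff n ≤ 1 :=
  Real.tsum_le_of_sum_range_le sqrtCoeff_nonneg sum_sqrtCoeff_le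

/-- In a Banach algebra, `1 - x` has a square root for every `x` in the closed unit ball: the
power series of `1 - √(1 - x)` still converges absolutely on the boundary. -/
lemma exists_sq_eq_one_sub {R : Type*} [NormedRing R] [NormedAlgebra ℝ R] [CompleteSpace R]
    (x : R) (hx : ‖x‖ ≤ 1) :
    ∃ y : R, HasSum (fun n => sqrtCoeff n • x ^ (n + 1)) y ∧ (1 - y) * (1 - y) = 1 - x := by
  have hn : ∀ n, ‖sqrtCoeff n • x ^ (n + 1)‖ ≤ sqrtCoeff n := fun n => by
    rw [norm_smul, Real.norm_of_nonneg (sqrtCoeff_nonneg n)]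
    exact mul_le_of_le_one_right (sqrtCoeff_nonneg n)
      ((norm_pow_le' x n.succ_pos).trans (pow_le_one₀ (norm_nonneg _) hx))
  have hs : Summable fun n => ‖sqrtCoeff n • x ^ (n + 1)‖ :=
    summable_sqrtCoeff.of_nonneg_of_le (fun _ => norm_nonneg _) hn
  refine ⟨_, hs.of_norm.hasSum, ?_⟩
  set y := ∑' n, sqrtCoeff n • x ^ (n + 1) with hy
  have hyy : y * y = 2 * y - x := by
    have h1 : y = sqrtCoeff 0 • x ^ 1 + ∑' n, sqrtCoeff (n + 1) • x ^ (n + 2) :=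
      hs.of_norm.tsum_eq_zero_add
    have h2 : y * y = ∑' n, (2 : ℝ) • sqrtCoeff (n + 1) • x ^ (n + 2) := by
      rw [hy, tsum_mul_tsum_eq_tsum_sum_antidiagonal_of_summable_norm hs hs]
      congr 1
      ext n
      rw [sqrtCoeff_succ, smul_smul, mul_div_cancel₀ _ two_ne_zero, Finset.sum_smul]
      refine Finset.sum_congr rfl fun p hp => ?_
      rw [smul_mul_smul_comm, ← pow_add, ← Finset.HasAntidiagonal.mem_antidiagonal.1 hp]
      congr 2
      ring
    rw [tsum_const_smul''] at h2
    have h3 : sqrtCoeff 0 = 1 / 2 := by simp [sqrtCoeff]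
    have h4 : (2 : ℝ) • y = 2 * y := by rw [two_smul, two_mul]
    rw [h2, ← h4]
    conv_rhs => rw [h1, h3]
    simp [smul_add, smul_smul]
  have : (1 - y) * (1 - y) = 1 - 2 * y + y * y := by noncomm_ring
  rw [this, hyy]
  noncomm_ring

variable {H : Type*} [NormedAddCommGroup H] [InnerProductSpace ℝ H] [CompleteSpace H]

/-- The operator `|A| = √(A²)` of a bounded self-adjoint operator `A` on a real Hilbert space. -/
lemma exists_abs_of_symmetric (A : H →L[ℝ] H) (hA : ∀ u v, inner ℝ (A u) v = inner ℝ u (A v)) :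
    ∃ S : H →L[ℝ] H, (∀ u, 0 ≤ inner ℝ (S u) u) ∧ S * S = A * A ∧
      (∀ u v, inner ℝ (S u) v = inner ℝ u (S v)) ∧
      ∀ C : H →L[ℝ] H, Commute A C → Commute S C := by
  set r : ℝ := ‖A‖ + 1
  have hr : 0 < r := by positivity
  set D : H →L[ℝ] H := r⁻¹ • A
  have hD1 : ∀ u, ‖D u‖ ≤ ‖u‖ := fun u => by
    have : ‖D u‖ ≤ r⁻¹ * (‖A‖ * ‖u‖) := by
      simp only [D, smul_apply, norm_smul, norm_inv, Real.norm_of_nonneg hr.le]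
      gcongr
      exact A.le_opNorm u
    refine this.trans ?_
    rw [inv_mul_le_iff₀ hr]
    gcongr
    simp [r]
  have hDs : ∀ u v, inner ℝ (D u) v = inner ℝ u (D v) := fun u v => by
    simp [D, inner_smul_left, inner_smul_right, hA]
  set X : H →L[ℝ] H := 1 - D * D
  have hX : ‖X‖ ≤ 1 := by
    refine ContinuousLinearMap.opNorm_le_bound _ zero_le_one fun u => ?_
    have h1 : ‖X u‖ ^ 2 = ‖u‖ ^ 2 - 2 * ‖D u‖ ^ 2 + ‖D (D u)‖ ^ 2 := by
      simp only [X, sub_apply, one_apply_eq_self,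
        mul_apply_eq_comp]
      rw [norm_sub_sq_real, ← hDs, real_inner_self_eq_norm_sq]
    have h2 := hD1 (D u)
    rw [one_mul]
    refine abs_le_of_sq_le_sq' ?_ (norm_nonneg u) |>.2
    nlinarith [norm_nonneg (D (D u)), norm_nonneg (D u)]
  obtain ⟨y, hy, hyy⟩ := exists_sq_eq_one_sub X hX
  have hXs : ∀ n u v, inner ℝ ((X ^ n) u) v = inner ℝ u ((X ^ n) v) := by
    intro n
    induction n with
    | zero => simp
    | succ n ih =>
      intro u v
      rw [pow_succ', mul_apply_eq_comp, ← (Commute.pow_self X n).eq,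
        mul_apply_eq_comp, ← ih]
      simp [X, inner_sub_left, inner_sub_right, hDs]
  have hap : ∀ u v, HasSum (fun n => sqrtCoeff n * inner ℝ ((X ^ (n + 1)) u) v)
      (inner ℝ (y u) v) := fun u v => by
    have h1 := hy.mapL (ContinuousLinearMap.apply ℝ H u)
    have h2 := h1.mapL (innerSL ℝ v)
    simpa [inner_smul_right, real_inner_comm] using h2
  have hys : ∀ u v, inner ℝ (y u) v = inner ℝ u (y v) := fun u v => by
    refine (hap u v).unique ?_
    rw [real_inner_comm]
    convert hap v u using 2 with n
    rw [hXs, real_inner_comm]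
  refine ⟨r • (1 - y), fun u => ?_, ?_, fun u v => ?_, fun C hC => ?_⟩
  · have h1 : inner ℝ (y u) u ≤ ‖u‖ ^ 2 := by
      refine (hasSum_le (fun n => ?_) (hap u u)
        (summable_sqrtCoeff.hasSum.mul_right (‖u‖ ^ 2))).trans ?_
      · gcongr
        · exact sqrtCoeff_nonneg n
        · refine (real_inner_le_norm _ _).trans ?_
          rw [pow_two]
          gcongr
          refine (ContinuousLinearMap.le_opNorm _ _).trans
            (mul_le_of_le_one_left (norm_nonneg _) ?_)
          exact (norm_pow_le' X n.succ_pos).trans (pow_le_one₀ (norm_nonneg _) hX)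
      · exact mul_le_of_le_one_left (by positivity) tsum_sqrtCoeff_le
    simp only [smul_apply, sub_apply,
      one_apply_eq_self, inner_smul_left, inner_sub_left, real_inner_self_eq_norm_sq]
    exact mul_nonneg hr.le (sub_nonneg.2 h1)
  · rw [smul_mul_smul_comm, hyy]
    simp only [X, sub_sub_cancel, D, smul_mul_smul_comm, smul_smul]
    rw [show r * r * (r⁻¹ * r⁻¹) = 1 by field_simp, one_smul]
  · simp [inner_smul_left, inner_smul_right, inner_sub_left, inner_sub_right, hys]
  · have hXC : Commute X C := by
      refine (Commute.one_left C).sub_left ?_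
      have : Commute D C := hC.smul_left _
      exact this.mul_left this
    refine Commute.smul_left ((Commute.one_left C).sub_left ?_) _
    refine (hy.mul_right C).unique ?_
    convert hy.mul_left C using 2 with n
    exact ((hXC.pow_left _).smul_left _).eq

/-- A substitute for the positive part `P` of `A`: it commutes with whatever commutes with `A`, the
form of `A` is non-negative on the range of `P`, and `A ≤ 0` if `P = 0`. -/
lemma exists_posPart_of_symmetric (A : H →L[ℝ] H)
    (hA : ∀ u v, inner ℝ (A u) v = inner ℝ u (A v)) :
    ∃ P : H →L[ℝ] H, (∀ u, 0 ≤ inner ℝ (A (P u)) (P u)) ∧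
      (∀ C : H →L[ℝ] H, Commute A C → Commute P C) ∧
      (P = 0 → ∀ u, inner ℝ (A u) u ≤ 0) := by
  obtain ⟨S, hS0, hSS, hSs, hSC⟩ := exists_abs_of_symmetric A hA
  have hSA : S * A = A * S := (hSC A (Commute.refl A)).eq
  refine ⟨S + A, fun u => ?_, fun C hC => (hSC C hC).add_left hC, fun hP u => ?_⟩
  · have : A * (S + A) = S * (S + A) := by rw [mul_add, mul_add, hSS, hSA, add_comm]
    have h2 : A ((S + A) u) = S ((S + A) u) := DFunLike.congr_fun this u
    rw [h2]
    exact hS0 _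
  · rw [← neg_eq_of_add_eq_zero_right hP]
    simpa using hS0 u

/-! ### The conditional inner product -/

section RelHilbert

variable {X : Type*} {m m0 : MeasurableSpace X} {μ : Measure X}

variable (m μ) in
/-- The conditional inner product `E(u v | m)` of `u, v ∈ L²(μ)`. -/
noncomputable def cip (u v : Lp ℝ 2 μ) : X → ℝ := μ[fun x => u x * v x | m]

lemma integrable_coe_mul (u v : Lp ℝ 2 μ) : Integrable (fun x => u x * v x) μ :=
  (Lp.memLp u).integrable_mul (Lp.memLp v)

lemma stronglyMeasurable_cip (u v : Lp ℝ 2 μ) : StronglyMeasurable[m] (cip m μ u v) :=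
  stronglyMeasurable_condExp

lemma integrable_cip (u v : Lp ℝ 2 μ) : Integrable (cip m μ u v) μ := integrable_condExp

lemma cip_comm (u v : Lp ℝ 2 μ) : cip m μ u v = cip m μ v u := by
  simp only [cip, mul_comm]

lemma cip_add_left (u v w : Lp ℝ 2 μ) :
    cip m μ (u + v) w =ᵐ[μ] cip m μ u w + cip m μ v w := by
  refine (condExp_congr_ae ?_).trans
    (condExp_add (integrable_coe_mul u w) (integrable_coe_mul v w) m)
  filter_upwards [Lp.coeFn_add u v] with x hx
  rw [hx, Pi.add_apply, Pi.add_apply, add_mul]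

lemma cip_sub_left (u v w : Lp ℝ 2 μ) :
    cip m μ (u - v) w =ᵐ[μ] cip m μ u w - cip m μ v w := by
  refine (condExp_congr_ae ?_).trans
    (condExp_sub (integrable_coe_mul u w) (integrable_coe_mul v w) m)
  filter_upwards [Lp.coeFn_sub u v] with x hx
  rw [hx, Pi.sub_apply, Pi.sub_apply, sub_mul]

lemma cip_smul_left (c : ℝ) (u w : Lp ℝ 2 μ) :
    cip m μ (c • u) w =ᵐ[μ] c • cip m μ u w := by
  refine (condExp_congr_ae ?_).trans (condExp_smul c (fun x => u x * w x) m)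
  filter_upwards [Lp.coeFn_smul c u] with x hx
  simp [hx, mul_assoc]

lemma cip_smul_smul (c : ℝ) (u : Lp ℝ 2 μ) :
    ∀ᵐ x ∂μ, cip m μ (c • u) (c • u) x = c ^ 2 * cip m μ u u x := by
  filter_upwards [cip_smul_left (m := m) c u (c • u), cip_smul_left (m := m) c u u] with x h1 h2
  rw [h1, Pi.smul_apply, cip_comm, h2, Pi.smul_apply, smul_eq_mul, smul_eq_mul, pow_two, mul_assoc]

lemma cip_self_nonneg (u : Lp ℝ 2 μ) : ∀ᵐ x ∂μ, 0 ≤ cip m μ u u x :=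
  condExp_nonneg (ae_of_all _ fun x => mul_self_nonneg (u x))

/-- The conditional inner product is bilinear, as a quadratic expansion. -/
lemma cip_add_smul_self (u v : Lp ℝ 2 μ) (c : ℝ) : ∀ᵐ x ∂μ, cip m μ (u + c • v) (u + c • v) x =
    cip m μ v v x * (c * c) + 2 * cip m μ u v x * c + cip m μ u u x := by
  filter_upwards [cip_add_left (m := m) u (c • v) (u + c • v), cip_add_left (m := m) u (c • v) u,
    cip_add_left (m := m) u (c • v) v, cip_smul_left (m := m) c v u, cip_smul_left (m := m) c v v,
    cip_smul_left (m := m) c v (u + c • v)] with x h1 h2 h3 h4 h5 h6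
  rw [h1, Pi.add_apply, h6, cip_comm u, h2, Pi.smul_apply, cip_comm v, Pi.add_apply, h3, h4,
    Pi.add_apply, Pi.smul_apply, h5, Pi.smul_apply, cip_comm v u]
  simp only [smul_eq_mul]
  ring

/-- The conditional Cauchy–Schwarz inequality. -/
lemma cip_sq_le (u v : Lp ℝ 2 μ) :
    ∀ᵐ x ∂μ, cip m μ u v x ^ 2 ≤ cip m μ u u x * cip m μ v v x := by
  have h : ∀ᵐ x ∂μ, ∀ q : ℚ, 0 ≤ cip m μ v v x * (q * q) + 2 * cip m μ u v x * q +
      cip m μ u u x := by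
    refine ae_all_iff.2 fun q => ?_
    filter_upwards [cip_add_smul_self (m := m) u v q,
      cip_self_nonneg (m := m) (u + (q : ℝ) • v)] with x h1 h2
    rwa [← h1]
  filter_upwards [h] with x hx
  have h2 : ∀ r : ℝ, 0 ≤ cip m μ v v x * (r * r) + 2 * cip m μ u v x * r + cip m μ u u x :=
    fun r => Rat.denseRange_cast.induction_on
      (p := fun r : ℝ => 0 ≤ cip m μ v v x * (r * r) + 2 * cip m μ u v x * r + cip m μ u u x)
      r (isClosed_le (by fun_prop) (by fun_prop)) hx
  have h3 := discrim_le_zero h2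
  rw [discrim] at h3
  linarith

lemma cip_eq_zero_of_self (u v : Lp ℝ 2 μ) :
    ∀ᵐ x ∂μ, cip m μ u u x = 0 → cip m μ v u x = 0 := by
  filter_upwards [cip_sq_le (m := m) v u] with x hx h0
  rw [h0, mul_zero] at hx
  exact pow_eq_zero_iff two_ne_zero |>.1 (le_antisymm hx (sq_nonneg _))

/-- A bound `‖u + v‖_y² ≤ 2 ‖u‖_y² + 2 ‖v‖_y²` for the fibre norms. -/
lemma cip_add_self_le (u v : Lp ℝ 2 μ) :
    ∀ᵐ x ∂μ, cip m μ (u + v) (u + v) x ≤ 2 * cip m μ u u x + 2 * cip m μ v v x := by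
  filter_upwards [cip_add_smul_self (m := m) u v 1, cip_add_smul_self (m := m) u v (-1),
    cip_self_nonneg (m := m) (u + (-1 : ℝ) • v)] with x h1 h2 h3
  rw [one_smul] at h1
  linarith

/-- Functions measurable over the factor can be pulled out of the conditional inner product. -/
lemma cip_mul_left {a : X → ℝ} (ha : StronglyMeasurable[m] a) {u w : Lp ℝ 2 μ}
    (hw : w =ᵐ[μ] fun x => a x * u x) (v : Lp ℝ 2 μ) :
    ∀ᵐ x ∂μ, cip m μ w v x = a x * cip m μ u v x := by
  have h1 : (fun x => w x * v x) =ᵐ[μ] a * fun x => u x * v x := by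
    filter_upwards [hw] with x hx
    simp [hx, mul_assoc]
  exact (condExp_congr_ae h1).trans (condExp_mul_of_stronglyMeasurable_left ha
    ((integrable_coe_mul w v).congr h1) (integrable_coe_mul u v))

lemma cip_indicator_left {S : Set X} (hS : MeasurableSet[m] S) {u w : Lp ℝ 2 μ}
    (hw : w =ᵐ[μ] S.indicator u) (v : Lp ℝ 2 μ) :
    ∀ᵐ x ∂μ, cip m μ w v x = S.indicator 1 x * cip m μ u v x := by
  refine cip_mul_left (stronglyMeasurable_one.indicator hS) ?_ v
  filter_upwards [hw] with x hx
  rw [hx]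
  by_cases h : x ∈ S <;> simp [h]

lemma cip_indicator_self {S : Set X} (hS : MeasurableSet[m] S) {u w : Lp ℝ 2 μ}
    (hw : w =ᵐ[μ] S.indicator u) :
    ∀ᵐ x ∂μ, cip m μ w w x = S.indicator 1 x * cip m μ u u x := by
  filter_upwards [cip_indicator_left hS hw w, cip_indicator_left hS hw u] with x h1 h2
  rw [h1, cip_comm, h2, ← mul_assoc]
  by_cases h : x ∈ S <;> simp [h]

/-- Multiplication by the indicator function of a measurable set, as an operator on `L²(μ)`. -/
noncomputable def indL {S : Set X} (hS : MeasurableSet S) : Lp ℝ 2 μ →L[ℝ] Lp ℝ 2 μ :=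
  LinearMap.mkContinuous
    { toFun := fun u => ((Lp.memLp u).indicator hS).toLp
      map_add' := fun u v => by
        rw [← MemLp.toLp_add]
        refine MemLp.toLp_congr _ _ ?_
        filter_upwards [Lp.coeFn_add u v] with x hx
        by_cases h : x ∈ S
        · simpa only [Set.indicator_of_mem h, Pi.add_apply] using hx
        · simp [h]
      map_smul' := fun c u => by
        rw [RingHom.id_apply, ← MemLp.toLp_const_smul]
        refine MemLp.toLp_congr _ _ ?_
        filter_upwards [Lp.coeFn_smul c u] with x hx
        by_cases h : x ∈ S <;> simp [h, hx] } 1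
    fun u => by
      rw [one_mul, LinearMap.coe_mk, AddHom.coe_mk, Lp.norm_toLp, Lp.norm_def]
      exact ENNReal.toReal_mono (Lp.eLpNorm_ne_top u) (eLpNorm_indicator_le _)

lemma coeFn_indL {S : Set X} (hS : MeasurableSet S) (u : Lp ℝ 2 μ) :
    indL hS u =ᵐ[μ] S.indicator u := by
  have h : indL hS u = ((Lp.memLp u).indicator hS).toLp := by rfl
  rw [h]
  exact MemLp.coeFn_toLp _

lemma norm_indL_le {S : Set X} (hS : MeasurableSet S) (u : Lp ℝ 2 μ) : ‖indL hS u‖ ≤ ‖u‖ := by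
  have := (indL (μ := μ) hS).le_of_opNorm_le (LinearMap.mkContinuous_norm_le _ zero_le_one _) u
  rwa [one_mul] at this

lemma inner_eq_integral (u v : Lp ℝ 2 μ) : inner ℝ u v = ∫ x, u x * v x ∂μ := by
  simp only [L2.inner_def, RCLike.inner_apply, conj_trivial, mul_comm]

lemma inner_indL_left {S : Set X} (hS : MeasurableSet S) (u v : Lp ℝ 2 μ) :
    inner ℝ (indL hS u) v = ∫ x in S, u x * v x ∂μ := by
  rw [inner_eq_integral, ← integral_indicator hS]
  refine integral_congr_ae ?_
  filter_upwards [coeFn_indL hS u] with x hx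
  by_cases h : x ∈ S <;> simp [h, hx]

lemma inner_indL_comm {S : Set X} (hS : MeasurableSet S) (u v : Lp ℝ 2 μ) :
    inner ℝ (indL hS u) v = inner ℝ u (indL hS v) := by
  rw [real_inner_comm (indL hS v), inner_indL_left, inner_indL_left]
  simp only [mul_comm]

variable [IsProbabilityMeasure μ] (hm : m ≤ m0)
include hm

lemma integral_cip (u v : Lp ℝ 2 μ) : ∫ x, cip m μ u v x ∂μ = inner ℝ u v := by
  rw [cip, integral_condExp hm, inner_eq_integral]

lemma integral_cip_self (u : Lp ℝ 2 μ) : ∫ x, cip m μ u u x ∂μ = ‖u‖ ^ 2 := by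
  rw [integral_cip hm, real_inner_self_eq_norm_sq]

lemma eq_zero_of_cip_self {u : Lp ℝ 2 μ} (h : cip m μ u u =ᵐ[μ] 0) : u = 0 := by
  have := integral_cip_self hm u
  rw [integral_congr_ae h] at this
  simpa using this.symm

lemma cip_eq_zero_iff (u v : Lp ℝ 2 μ) :
    cip m μ u v =ᵐ[μ] 0 ↔
      ∀ (S : Set X) (hS : MeasurableSet[m] S), inner ℝ (indL (hm S hS) u) v = 0 := by
  constructor
  · intro h S hS
    rw [inner_indL_left, ← setIntegral_condExp hm (integrable_coe_mul u v) hS]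
    rw [setIntegral_congr_ae (g := fun _ => (0 : ℝ)) (hm S hS)]
    · simp
    · filter_upwards [h] with x hx _ using hx
  · intro h
    refine (ae_eq_condExp_of_forall_setIntegral_eq hm (integrable_coe_mul u v) (g := 0)
      (fun _ _ _ => integrableOn_zero) (fun S hS _ => ?_)
      stronglyMeasurable_zero.aestronglyMeasurable).symm
    rw [← inner_indL_left (hm S hS), h S hS]
    simp

/-- If `a² E(u² | m)` is dominated by an integrable function then `a u` is square integrable. -/
lemma memLp_mul_of_le {a F : X → ℝ} (ha : StronglyMeasurable[m] a) (hF : Integrable F μ)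
    (u : Lp ℝ 2 μ) (h : ∀ᵐ x ∂μ, a x ^ 2 * cip m μ u u x ≤ F x) :
    MemLp (fun x => a x * u x) 2 μ := by
  have hum : AEMeasurable u μ := (Lp.aestronglyMeasurable u).aemeasurable
  have hcm : AEMeasurable (cip m μ u u) μ :=
    ((stronglyMeasurable_cip u u).mono hm).measurable.aemeasurable
  -- The measures with densities `u²` and `E(u² | m)` agree on `m`.
  have key : (μ.withDensity fun x => ENNReal.ofReal (u x * u x)).trim hm =
      (μ.withDensity fun x => ENNReal.ofReal (cip m μ u u x)).trim hm := by
    refine @Measure.ext _ m _ _ fun S hS => ?_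
    rw [trim_measurableSet_eq hm hS, trim_measurableSet_eq hm hS, withDensity_apply _ (hm S hS),
      withDensity_apply _ (hm S hS),
      ← ofReal_integral_eq_lintegral_ofReal (integrable_coe_mul u u).integrableOn
        (ae_of_all _ fun x => mul_self_nonneg (u x)),
      ← ofReal_integral_eq_lintegral_ofReal (integrable_cip u u).integrableOn
        (ae_restrict_of_ae (cip_self_nonneg u)), cip,
      setIntegral_condExp hm (integrable_coe_mul u u) hS]
  have ham : Measurable[m] fun x => ENNReal.ofReal (a x ^ 2) :=
    (ha.measurable.pow_const 2).ennreal_ofReal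
  have h1 : ∫⁻ x, ENNReal.ofReal (a x ^ 2) * ENNReal.ofReal (u x * u x) ∂μ =
      ∫⁻ x, ENNReal.ofReal (a x ^ 2) * ENNReal.ofReal (cip m μ u u x) ∂μ := by
    have := congrArg (fun ρ => @lintegral _ m ρ fun x => ENNReal.ofReal (a x ^ 2)) key
    simp only [lintegral_trim hm ham] at this
    rw [lintegral_withDensity_eq_lintegral_mul₀ (f := fun x => ENNReal.ofReal (u x * u x))
      (hum.mul hum).ennreal_ofReal
      (ham.mono hm le_rfl).aemeasurable, lintegral_withDensity_eq_lintegral_mul₀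
      hcm.ennreal_ofReal (ham.mono hm le_rfl).aemeasurable] at this
    simpa only [Pi.mul_apply, mul_comm] using this
  have hmeas : AEStronglyMeasurable (fun x => a x * u x) μ :=
    (ha.mono hm).aestronglyMeasurable.mul (Lp.aestronglyMeasurable u)
  rw [memLp_two_iff_integrable_sq hmeas]
  refine ⟨hmeas.pow 2, ?_⟩
  rw [hasFiniteIntegral_iff_ofReal (ae_of_all _ fun x => sq_nonneg _)]
  calc ∫⁻ x, ENNReal.ofReal ((a x * u x) ^ 2) ∂μ
      = ∫⁻ x, ENNReal.ofReal (a x ^ 2) * ENNReal.ofReal (u x * u x) ∂μ := by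
        refine lintegral_congr fun x => ?_
        rw [← ENNReal.ofReal_mul (sq_nonneg _), mul_pow, ← pow_two (u x)]
    _ ≤ ∫⁻ x, ENNReal.ofReal (F x) ∂μ := by
        rw [h1]
        refine lintegral_mono_ae ?_
        filter_upwards [h] with x hx
        rw [← ENNReal.ofReal_mul (sq_nonneg _)]
        exact ENNReal.ofReal_le_ofReal hx
    _ < ∞ := hF.lintegral_lt_top

omit [IsProbabilityMeasure μ] hm in
lemma measurableSet_cip_le (h : Lp ℝ 2 μ) (C : ℝ) : MeasurableSet[m] {x | cip m μ h h x ≤ C} :=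
  measurableSet_le (stronglyMeasurable_cip h h).measurable measurable_const

omit [IsProbabilityMeasure μ] hm in
lemma cip_truncation_le {h w : Lp ℝ 2 μ} {C : ℝ} (hC : 0 ≤ C)
    (hw : w =ᵐ[μ] {x | cip m μ h h x ≤ C}.indicator h) : ∀ᵐ x ∂μ, cip m μ w w x ≤ C := by
  filter_upwards [cip_indicator_self (measurableSet_cip_le h C) hw] with x hx
  rw [hx]
  by_cases hxS : x ∈ {x | cip m μ h h x ≤ C}
  · rw [Set.indicator_of_mem hxS, Pi.one_apply, one_mul]
    exact hxS
  · rwa [Set.indicator_of_notMem hxS, zero_mul]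

omit [IsProbabilityMeasure μ] in
/-- Orthogonality can be checked after truncation to the sets where the fibre norm is bounded. -/
lemma inner_eq_zero_of_truncations {h v : Lp ℝ 2 μ} (h0 : ∀ (n : ℕ) (w : Lp ℝ 2 μ),
    w =ᵐ[μ] {x | cip m μ h h x ≤ n}.indicator h → inner ℝ w v = 0) : inner ℝ h v = 0 := by
  set S : ℕ → Set X := fun n => {x | cip m μ h h x ≤ n}
  have hS : ∀ n, MeasurableSet (S n) := fun n => hm _ (measurableSet_cip_le h n)
  have h1 : ∀ n, ∫ x in S n, h x * v x ∂μ = 0 := fun n => by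
    rw [← inner_indL_left (hS n)]
    exact h0 n _ (coeFn_indL _ _)
  have hU : ⋃ n, S n = Set.univ := Set.eq_univ_of_forall fun x =>
    Set.mem_iUnion.2 (exists_nat_ge (cip m μ h h x))
  have hmono : Monotone S := fun i j hij x hx =>
    show cip m μ h h x ≤ j from le_trans (show cip m μ h h x ≤ i from hx) (by exact_mod_cast hij)
  have ht := tendsto_setIntegral_of_monotone (μ := μ) (f := fun x => h x * v x) hS hmono
    (integrable_coe_mul h v).integrableOn
  simp only [h1, hU, setIntegral_univ] at ht
  rw [inner_eq_integral]
  exact tendsto_nhds_unique ht tendsto_const_nhds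

end RelHilbert

/-! ### Modules over the factor algebra -/

section RelModule

variable {X : Type*} {m m0 : MeasurableSpace X} {μ : Measure X}

variable (m) in
/-- A closed `L^∞(m)`-submodule of `L²(μ)`. It suffices to require stability under
multiplication by indicator functions of `m`-measurable sets, see `IsRelModule.mem_of_mul`. -/
structure IsRelModule (M : Submodule ℝ (Lp ℝ 2 μ)) : Prop where
  isClosed : IsClosed (M : Set (Lp ℝ 2 μ))
  indicator_mem : ∀ S : Set X, MeasurableSet[m] S → ∀ u ∈ M, ∀ w : Lp ℝ 2 μ,
    w =ᵐ[μ] S.indicator u → w ∈ M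

/-- The topological closure of a subspace stable under indicator functions is a closed module. -/
lemma isRelModule_topologicalClosure (hm : m ≤ m0) (M : Submodule ℝ (Lp ℝ 2 μ))
    (h : ∀ S : Set X, MeasurableSet[m] S → ∀ u ∈ M, ∀ w : Lp ℝ 2 μ,
      w =ᵐ[μ] S.indicator u → w ∈ M) : IsRelModule m M.topologicalClosure := by
  refine ⟨M.isClosed_topologicalClosure, fun S hS u hu w hw => ?_⟩
  have h1 : w = indL (hm S hS) u := Lp.ext (hw.trans (coeFn_indL _ u).symm)
  rw [h1]
  exact map_mem_closure (indL (hm S hS)).continuous hu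
    fun v hv => h S hS v hv _ (coeFn_indL _ v)

lemma IsRelModule.inf {M N : Submodule ℝ (Lp ℝ 2 μ)} (hM : IsRelModule m M)
    (hN : IsRelModule m N) : IsRelModule m (M ⊓ N) :=
  ⟨hM.isClosed.inter hN.isClosed, fun S hS u hu w hw =>
    ⟨hM.indicator_mem S hS u hu.1 w hw, hN.indicator_mem S hS u hu.2 w hw⟩⟩

lemma mem_of_forall_orthogonal {M : Submodule ℝ (Lp ℝ 2 μ)}
    (hM : IsClosed (M : Set (Lp ℝ 2 μ))) {w : Lp ℝ 2 μ}
    (h : ∀ v ∈ Mᗮ, inner ℝ v w = 0) : w ∈ M := by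
  have : w ∈ Mᗮᗮ := (Submodule.mem_orthogonal _ _).2 h
  rwa [Submodule.orthogonal_orthogonal_eq_closure, hM.submodule_topologicalClosure_eq] at this

variable [IsProbabilityMeasure μ]

/-- Orthogonality to a closed module is orthogonality in almost every fibre. -/
lemma IsRelModule.cip_eq_zero (hm : m ≤ m0) {M : Submodule ℝ (Lp ℝ 2 μ)} (hM : IsRelModule m M)
    {u v : Lp ℝ 2 μ} (hu : u ∈ M) (hv : v ∈ Mᗮ) : cip m μ u v =ᵐ[μ] 0 :=
  (cip_eq_zero_iff hm u v).2 fun S hS =>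
    Submodule.inner_right_of_mem_orthogonal
      (hM.indicator_mem S hS u hu _ (coeFn_indL (hm S hS) u)) hv

/-- A closed module contains every square-integrable multiple of its elements by a function
measurable over the factor, bounded or not. -/
lemma IsRelModule.mem_of_mul (hm : m ≤ m0) {M : Submodule ℝ (Lp ℝ 2 μ)} (hM : IsRelModule m M)
    {a : X → ℝ} (ha : StronglyMeasurable[m] a) {u w : Lp ℝ 2 μ} (hu : u ∈ M)
    (hw : w =ᵐ[μ] fun x => a x * u x) : w ∈ M := by
  refine mem_of_forall_orthogonal hM.isClosed fun v hv => ?_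
  rw [real_inner_comm, ← integral_cip hm]
  refine integral_eq_zero_of_ae ?_
  filter_upwards [cip_mul_left ha hw v, hM.cip_eq_zero hm hu hv] with x h1 h2
  rw [h1, h2]
  simp

omit [IsProbabilityMeasure μ] in
lemma IsRelModule.orthogonal (hm : m ≤ m0) {M : Submodule ℝ (Lp ℝ 2 μ)} (hM : IsRelModule m M) :
    IsRelModule m Mᗮ := by
  refine ⟨M.isClosed_orthogonal, fun S hS u hu w hw => (Submodule.mem_orthogonal _ _).2
    fun v hv => ?_⟩
  have h1 : w = indL (hm S hS) u := Lp.ext (hw.trans (coeFn_indL _ u).symm)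
  rw [h1, ← inner_indL_comm]
  exact Submodule.inner_right_of_mem_orthogonal
    (hM.indicator_mem S hS v hv _ (coeFn_indL (hm S hS) v)) hu

variable (m) in
/-- The module of all `v ∈ L²(μ)` with `E(v u | m) = 0` for every `u` in a family. -/
def relOrthogonal {ι : Type*} (ψ : ι → Lp ℝ 2 μ) : Submodule ℝ (Lp ℝ 2 μ) where
  carrier := {v | ∀ i, cip m μ v (ψ i) =ᵐ[μ] 0}
  zero_mem' i := by
    filter_upwards [cip_smul_left (m := m) 0 (0 : Lp ℝ 2 μ) (ψ i)] with x hx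
    rw [zero_smul] at hx
    simpa using hx
  add_mem' {u v} hu hv i := by
    filter_upwards [cip_add_left (m := m) u v (ψ i), hu i, hv i] with x h1 h2 h3
    simp [h1, h2, h3]
  smul_mem' c u hu i := by
    filter_upwards [cip_smul_left (m := m) c u (ψ i), hu i] with x h1 h2
    simp [h1, h2]

omit [IsProbabilityMeasure μ] in
lemma mem_relOrthogonal {ι : Type*} {ψ : ι → Lp ℝ 2 μ} {v : Lp ℝ 2 μ} :
    v ∈ relOrthogonal m ψ ↔ ∀ i, cip m μ v (ψ i) =ᵐ[μ] 0 := Iff.rfl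

lemma isRelModule_relOrthogonal (hm : m ≤ m0) {ι : Type*} (ψ : ι → Lp ℝ 2 μ) :
    IsRelModule m (relOrthogonal m ψ) := by
  refine ⟨?_, fun S hS u hu w hw i => ?_⟩
  · have : (relOrthogonal m ψ : Set (Lp ℝ 2 μ)) =
        ⋂ (i) (S : Set X) (hS : MeasurableSet[m] S), {v | inner ℝ (indL (hm S hS) v) (ψ i) = 0} := by
      ext v
      simp only [SetLike.mem_coe, mem_relOrthogonal, cip_eq_zero_iff hm, Set.mem_iInter,
        Set.mem_ofPred_eq]
    rw [this]
    exact isClosed_iInter fun i => isClosed_iInter fun S => isClosed_iInter fun hS =>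
      isClosed_eq (by fun_prop) continuous_const
  · filter_upwards [cip_indicator_left hS hw (ψ i), hu i] with x h1 h2
    rw [h1, h2]
    simp

/-! ### Relative orthonormalisation -/

/-- Every `u ∈ L²(μ)` can be divided by its fibre norms, where these do not vanish. -/
lemma exists_normalize (hm : m ≤ m0) (u : Lp ℝ 2 μ) :
    ∃ (ψ : Lp ℝ 2 μ) (a : X → ℝ), StronglyMeasurable[m] a ∧ ψ =ᵐ[μ] (fun x => a x * u x) ∧
      cip m μ ψ ψ =ᵐ[μ] {x | 0 < cip m μ u u x}.indicator 1 ∧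
      ∀ v, cip m μ v ψ =ᵐ[μ] 0 → cip m μ v u =ᵐ[μ] 0 := by
  set a : X → ℝ := fun x => (√(cip m μ u u x))⁻¹
  have ha : StronglyMeasurable[m] a :=
    (stronglyMeasurable_cip u u).measurable.sqrt.inv.stronglyMeasurable
  have hL : MemLp (fun x => a x * u x) 2 μ := by
    refine memLp_mul_of_le hm ha (integrable_const (1 : ℝ)) u ?_
    filter_upwards [cip_self_nonneg (m := m) u] with x hx
    simp only [a, inv_pow, Real.sq_sqrt hx]
    exact inv_mul_le_one
  refine ⟨hL.toLp, a, ha, hL.coeFn_toLp, ?_, fun v hv => ?_⟩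
  · filter_upwards [cip_mul_left ha hL.coeFn_toLp hL.toLp, cip_mul_left ha hL.coeFn_toLp u,
      cip_self_nonneg (m := m) u] with x h1 h2 h3
    rw [h1, cip_comm, h2]
    by_cases h : 0 < cip m μ u u x
    · rw [Set.indicator_of_mem (by exact h), ← mul_assoc, ← pow_two]
      simp only [a, inv_pow, Real.sq_sqrt h3, Pi.one_apply]
      exact inv_mul_cancel₀ h.ne'
    · rw [Set.indicator_of_notMem (by exact h), le_antisymm (not_lt.1 h) h3]
      simp
  · filter_upwards [cip_mul_left ha hL.coeFn_toLp v, cip_self_nonneg (m := m) u,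
      cip_eq_zero_of_self (m := m) u v, hv] with x h1 h2 h3 h4
    rcases h2.eq_or_lt with h | h
    · exact h3 h.symm
    · rw [cip_comm, h1] at h4
      rw [cip_comm]
      exact (mul_eq_zero.1 h4).resolve_left (inv_ne_zero (Real.sqrt_pos.2 h).ne')

variable (m) in
/-- A relatively orthonormal family: in each fibre its members are pairwise orthogonal, and each of
them has norm `0` or `1`. -/
structure IsRelOrthonormal {ι : Type*} (ψ : ι → Lp ℝ 2 μ) : Prop where
  orthogonal : ∀ i j, i ≠ j → cip m μ (ψ i) (ψ j) =ᵐ[μ] 0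
  norm_eq : ∀ i, ∃ A : Set X, MeasurableSet[m] A ∧ cip m μ (ψ i) (ψ i) =ᵐ[μ] A.indicator 1

omit [IsProbabilityMeasure μ] in
lemma IsRelOrthonormal.self_le_one {ι : Type*} {ψ : ι → Lp ℝ 2 μ} (h : IsRelOrthonormal m ψ)
    (i : ι) : ∀ᵐ x ∂μ, cip m μ (ψ i) (ψ i) x ≤ 1 := by
  obtain ⟨A, -, hA⟩ := h.norm_eq i
  filter_upwards [hA] with x hx
  rw [hx]
  by_cases h : x ∈ A <;> simp [h]

omit [IsProbabilityMeasure μ] in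
lemma IsRelOrthonormal.cip_mul_self {ι : Type*} {ψ : ι → Lp ℝ 2 μ} (h : IsRelOrthonormal m ψ)
    (u : Lp ℝ 2 μ) (i : ι) :
    ∀ᵐ x ∂μ, cip m μ u (ψ i) x * cip m μ (ψ i) (ψ i) x = cip m μ u (ψ i) x := by
  obtain ⟨A, -, hA⟩ := h.norm_eq i
  filter_upwards [hA, cip_eq_zero_of_self (m := m) (ψ i) u] with x hx h0
  by_cases hxA : x ∈ A
  · simp [hx, hxA]
  · rw [h0 (by simp [hx, hxA]), zero_mul]

/-- The projection of `u` to the module generated by a relatively orthonormal family. -/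
lemma IsRelOrthonormal.exists_proj (hm : m ≤ m0) {ι : Type*} [Fintype ι] {ψ : ι → Lp ℝ 2 μ}
    (h : IsRelOrthonormal m ψ) (u : Lp ℝ 2 μ) :
    ∃ w : Lp ℝ 2 μ, w =ᵐ[μ] (fun x => ∑ i, cip m μ u (ψ i) x * ψ i x) ∧
      (∀ v, ∀ᵐ x ∂μ, cip m μ w v x = ∑ i, cip m μ u (ψ i) x * cip m μ (ψ i) v x) ∧
      u - w ∈ relOrthogonal m ψ := by
  classical
  have hL : ∀ i, MemLp (fun x => cip m μ u (ψ i) x * ψ i x) 2 μ := fun i => by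
    refine memLp_mul_of_le hm (stronglyMeasurable_cip _ _) (integrable_cip (m := m) u u) (ψ i) ?_
    filter_upwards [h.cip_mul_self u i, cip_sq_le (m := m) u (ψ i), h.self_le_one i,
      cip_self_nonneg (m := m) u] with x h1 h2 h3 h4
    rw [pow_two, mul_assoc, h1, ← pow_two]
    exact h2.trans (mul_le_of_le_one_right h4 h3)
  have key : ∀ v, ∀ᵐ x ∂μ, cip m μ (∑ i, (hL i).toLp) v x =
      ∑ i, cip m μ u (ψ i) x * cip m μ (ψ i) v x := by
    intro v
    have h1 : ∀ s : Finset ι, ∀ᵐ x ∂μ, cip m μ (∑ i ∈ s, (hL i).toLp) v x =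
        ∑ i ∈ s, cip m μ u (ψ i) x * cip m μ (ψ i) v x := by
      intro s
      induction s using Finset.induction_on with
      | empty =>
        filter_upwards [(relOrthogonal m (fun _ : Unit => v)).zero_mem ()] with x hx
        simpa only [Finset.sum_empty, Pi.zero_apply] using hx
      | insert i s hi ih =>
        rw [Finset.sum_insert hi]
        filter_upwards [ih, cip_add_left (m := m) (hL i).toLp (∑ i ∈ s, (hL i).toLp) v,
          cip_mul_left (stronglyMeasurable_cip u (ψ i)) (hL i).coeFn_toLp v] with x h1 h2 h3
        rw [h2, Pi.add_apply, h1, h3, Finset.sum_insert hi]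
    exact h1 Finset.univ
  refine ⟨∑ i, (hL i).toLp, ?_, key, fun j => ?_⟩
  · have h1 : ∀ s : Finset ι, (∑ i ∈ s, (hL i).toLp : Lp ℝ 2 μ) =ᵐ[μ]
        fun x => ∑ i ∈ s, cip m μ u (ψ i) x * ψ i x := by
      intro s
      induction s using Finset.induction_on with
      | empty => exact ae_of_all _ fun x => by simp
      | insert i s hi ih =>
        rw [Finset.sum_insert hi]
        filter_upwards [ih, Lp.coeFn_add (hL i).toLp (∑ i ∈ s, (hL i).toLp),
          (hL i).coeFn_toLp] with x h1 h2 h3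
        rw [h2, Pi.add_apply, h1, h3, Finset.sum_insert hi]
    exact h1 Finset.univ
  · have h0 : ∀ᵐ x ∂μ, ∀ i, i ≠ j → cip m μ (ψ i) (ψ j) x = 0 :=
      ae_all_iff.2 fun i => by
        by_cases hij : i = j
        · exact ae_of_all _ fun x hx => absurd hij hx
        · filter_upwards [h.orthogonal i j hij] with x hx _ using hx
    filter_upwards [cip_sub_left (m := m) u (∑ i, (hL i).toLp) (ψ j), key (ψ j), h0,
      h.cip_mul_self u j] with x h1 h2 h3 h4
    rw [h1, Pi.sub_apply, h2, Finset.sum_eq_single j (fun i _ hi => by rw [h3 i hi, mul_zero])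
      (fun hj => absurd (Finset.mem_univ j) hj), h4]
    simp

/-- An element orthogonal to the annihilator of a finite relatively orthonormal family is the sum
of its relative Fourier series. -/
lemma IsRelOrthonormal.ae_eq_sum (hm : m ≤ m0) {ι : Type*} [Fintype ι] {ψ : ι → Lp ℝ 2 μ}
    (h : IsRelOrthonormal m ψ) {u : Lp ℝ 2 μ} (hu : u ∈ (relOrthogonal m ψ)ᗮ) :
    u =ᵐ[μ] fun x => ∑ i, cip m μ u (ψ i) x * ψ i x := by
  obtain ⟨w, hw, hwc, hmem⟩ := h.exists_proj hm u
  have h1 : inner ℝ (u - w) u = 0 := Submodule.inner_right_of_mem_orthogonal hmem hu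
  have h2 : inner ℝ w (u - w) = 0 := by
    rw [← integral_cip hm]
    refine integral_eq_zero_of_ae ?_
    filter_upwards [hwc (u - w), ae_all_iff.2 hmem] with x h1 h2
    rw [h1]
    refine Finset.sum_eq_zero fun i _ => ?_
    rw [cip_comm (ψ i), h2 i]
    simp
  have h3 : u - w = 0 := by
    rw [← inner_self_eq_zero (𝕜 := ℝ), inner_sub_right, h1, real_inner_comm, h2, sub_zero]
  have h4 : w = u := (sub_eq_zero.1 h3).symm
  subst h4
  exact hw

omit [IsProbabilityMeasure μ] in
lemma IsRelOrthonormal.snoc {n : ℕ} {ψ : Fin n → Lp ℝ 2 μ} (h : IsRelOrthonormal m ψ)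
    {p : Lp ℝ 2 μ} (hp : p ∈ relOrthogonal m ψ)
    (hA : ∃ A : Set X, MeasurableSet[m] A ∧ cip m μ p p =ᵐ[μ] A.indicator 1) :
    IsRelOrthonormal m (Fin.snoc ψ p : Fin (n + 1) → Lp ℝ 2 μ) := by
  refine ⟨fun i j hij => ?_, fun i => ?_⟩
  · induction i using Fin.lastCases with
    | last =>
      induction j using Fin.lastCases with
      | last => exact absurd rfl hij
      | cast j =>
        rw [Fin.snoc_last, Fin.snoc_castSucc]
        exact hp j
    | cast i =>
      induction j using Fin.lastCases with
      | last =>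
        rw [Fin.snoc_last, Fin.snoc_castSucc, cip_comm]
        exact hp i
      | cast j =>
        rw [Fin.snoc_castSucc, Fin.snoc_castSucc]
        exact h.orthogonal i j fun hij' => hij (by rw [hij'])
  · induction i using Fin.lastCases with
    | last => rwa [Fin.snoc_last]
    | cast i =>
      rw [Fin.snoc_castSucc]
      exact h.norm_eq i

/-- Relative Gram–Schmidt orthonormalisation. -/
lemma exists_isRelOrthonormal (hm : m ≤ m0) (d : ℕ) (φ : Fin d → Lp ℝ 2 μ) :
    ∃ ψ : Fin d → Lp ℝ 2 μ, IsRelOrthonormal m ψ ∧ relOrthogonal m ψ ≤ relOrthogonal m φ := by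
  induction d with
  | zero => exact ⟨φ, ⟨fun i => i.elim0, fun i => i.elim0⟩, le_rfl⟩
  | succ d ih =>
    obtain ⟨ψ, hψ, hle⟩ := ih fun i => φ i.castSucc
    obtain ⟨w, hw, hwc, hmem⟩ := hψ.exists_proj hm (φ (Fin.last d))
    obtain ⟨p, a, ha, hpa, hpp, hpv⟩ := exists_normalize hm (φ (Fin.last d) - w)
    refine ⟨Fin.snoc ψ p, hψ.snoc ((isRelModule_relOrthogonal hm ψ).mem_of_mul hm ha hmem hpa)
      ⟨_, ?_, hpp⟩, fun v hv i => ?_⟩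
    · exact measurableSet_lt measurable_const (stronglyMeasurable_cip _ _).measurable
    · have hv' : v ∈ relOrthogonal m ψ := fun j => by
        simpa only [Fin.snoc_castSucc] using hv j.castSucc
      induction i using Fin.lastCases with
      | cast i => exact hle hv' i
      | last =>
        have hvp := hv (Fin.last d)
        rw [Fin.snoc_last] at hvp
        filter_upwards [hpv v hvp, cip_sub_left (m := m) (φ (Fin.last d)) w v, hwc v,
          ae_all_iff.2 hv'] with x h1 h2 h3 h4
        rw [cip_comm, h2, Pi.sub_apply, h3, Finset.sum_eq_zero fun i _ => by
          rw [cip_comm (ψ i), h4 i, Pi.zero_apply, mul_zero], sub_zero] at h1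
        rw [cip_comm, h1]

/-! ### Closed modules of bounded dimension -/

/-- A closed module in a separable `L²(μ)` has an element whose fibre norm is `1` wherever the
fibre of the module is not zero. -/
lemma IsRelModule.exists_full_support [SecondCountableTopology (Lp ℝ 2 μ)] (hm : m ≤ m0)
    {N : Submodule ℝ (Lp ℝ 2 μ)} (hN : IsRelModule m N) :
    ∃ ψ ∈ N, ∃ A : Set X, MeasurableSet[m] A ∧ cip m μ ψ ψ =ᵐ[μ] A.indicator 1 ∧
      ∀ h ∈ N, ∀ᵐ x ∂μ, x ∉ A → cip m μ h h x = 0 := by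
  set f : ℕ → N := TopologicalSpace.denseSeq N
  set S : ℕ → Set X := fun n => {x | 0 < cip m μ (f n : Lp ℝ 2 μ) (f n) x}
  have hS : ∀ n, MeasurableSet[m] (S n) := fun n =>
    measurableSet_lt measurable_const (stronglyMeasurable_cip _ _).measurable
  have hD : ∀ n, MeasurableSet[m] (disjointed S n) := fun n =>
    @MeasurableSet.disjointed X m S hS n
  set c : ℕ → ℝ := fun n => (1 / 2) ^ n / (1 + ‖(f n : Lp ℝ 2 μ)‖)
  have hc : ∀ n, 0 < c n := fun n => by positivity
  -- The terms live on disjoint sets, so that their sum vanishes only where all of them do.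
  set t : ℕ → Lp ℝ 2 μ := fun n => c n • indL (hm _ (hD n)) (f n : Lp ℝ 2 μ)
  have htN : ∀ n, t n ∈ N := fun n =>
    N.smul_mem _ (hN.indicator_mem _ (hD n) _ (f n).2 _ (coeFn_indL _ _))
  have hts : Summable t := by
    refine Summable.of_norm_bounded (g := fun n => (1 / 2 : ℝ) ^ n) summable_geometric_two
      fun n => ?_
    simp only [t]
    rw [norm_smul, Real.norm_of_nonneg (hc n).le, div_mul_eq_mul_div]
    refine div_le_of_le_mul₀ (by positivity) (by positivity) ?_
    gcongr
    exact (norm_indL_le _ _).trans (by linarith)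
  have hind : ∀ n, indL (hm _ (hD n)) (∑' k, t k) = t n := by
    intro n
    have h1 := hts.hasSum.mapL (indL (μ := μ) (hm _ (hD n)))
    refine h1.unique ?_
    convert hasSum_single (f := fun k => indL (hm _ (hD n)) (t k)) n ?_ using 1
    · refine Lp.ext ?_
      filter_upwards [coeFn_indL (hm _ (hD n)) (t n), coeFn_indL (hm _ (hD n)) (f n : Lp ℝ 2 μ),
        Lp.coeFn_smul (c n) (indL (hm _ (hD n)) (f n : Lp ℝ 2 μ))] with x h1 h2 h3
      rw [h1]
      by_cases hx : x ∈ disjointed S n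
      · rw [Set.indicator_of_mem hx]
      · rw [Set.indicator_of_notMem hx]
        simp only [t]
        rw [h3, Pi.smul_apply, h2, Set.indicator_of_notMem hx, smul_zero]
    · intro k hk
      refine Lp.ext ?_
      filter_upwards [coeFn_indL (hm _ (hD n)) (t k), coeFn_indL (hm _ (hD k)) (f k : Lp ℝ 2 μ),
        Lp.coeFn_smul (c k) (indL (hm _ (hD k)) (f k : Lp ℝ 2 μ)), Lp.coeFn_zero ℝ 2 μ]
        with x h1 h2 h3 h4
      rw [h1, h4, Pi.zero_apply]
      by_cases hx : x ∈ disjointed S n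
      · have hxk : x ∉ disjointed S k := fun hxk =>
          Set.disjoint_left.1 (disjoint_disjointed S hk) hxk hx
        rw [Set.indicator_of_mem hx]
        simp only [t]
        rw [h3, Pi.smul_apply, h2, Set.indicator_of_notMem hxk, smul_zero]
      · rw [Set.indicator_of_notMem hx]
  set ψ₀ : Lp ℝ 2 μ := ∑' k, t k
  have hψ₀ : ψ₀ ∈ N := hN.isClosed.mem_of_tendsto hts.hasSum
    (Eventually.of_forall fun s => N.sum_mem fun i _ => htN i)
  have hpos : ∀ᵐ x ∂μ, ∀ n, x ∈ S n → 0 < cip m μ ψ₀ ψ₀ x := by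
    have h1 : ∀ᵐ x ∂μ, ∀ n, x ∈ disjointed S n → 0 < cip m μ ψ₀ ψ₀ x := by
      refine ae_all_iff.2 fun n => ?_
      filter_upwards [cip_indicator_self (hD n) (coeFn_indL (hm _ (hD n)) ψ₀),
        cip_smul_smul (m := m) (c n) (indL (hm _ (hD n)) (f n : Lp ℝ 2 μ)),
        cip_indicator_self (hD n) (coeFn_indL (hm _ (hD n)) (f n : Lp ℝ 2 μ))] with x h1 h2 h3 hx
      rw [hind n] at h1
      simp only [t] at h1
      rw [h2, h3, Set.indicator_of_mem hx, Pi.one_apply, one_mul, one_mul] at h1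
      rw [← h1]
      exact mul_pos (pow_pos (hc n) 2) (disjointed_subset S n hx)
    filter_upwards [h1] with x hx n hn
    have : x ∈ ⋃ n, disjointed S n := by
      rw [iUnion_disjointed]
      exact Set.mem_iUnion.2 ⟨n, hn⟩
    obtain ⟨k, hk⟩ := Set.mem_iUnion.1 this
    exact hx k hk
  obtain ⟨ψ, a, ha, hψa, hψψ, -⟩ := exists_normalize hm ψ₀
  have hA : MeasurableSet[m] {x | 0 < cip m μ ψ₀ ψ₀ x} :=
    measurableSet_lt measurable_const (stronglyMeasurable_cip _ _).measurable
  refine ⟨ψ, hN.mem_of_mul hm ha hψ₀ hψa, _, hA, hψψ, fun h hh => ?_⟩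
  set h' := indL (hm _ hA.compl) h
  have hh' : h' ∈ N := hN.indicator_mem _ hA.compl h hh _ (coeFn_indL _ _)
  have h0 : ∀ n, inner ℝ h' (f n : Lp ℝ 2 μ) = 0 := by
    intro n
    rw [← integral_cip hm]
    refine integral_eq_zero_of_ae ?_
    filter_upwards [cip_indicator_left hA.compl (coeFn_indL (hm _ hA.compl) h) (f n), hpos,
      cip_self_nonneg (m := m) (f n : Lp ℝ 2 μ), cip_eq_zero_of_self (m := m) (f n : Lp ℝ 2 μ) h]
      with x h1 h2 h3 h4
    rw [h1]
    by_cases hx : x ∈ {x | 0 < cip m μ ψ₀ ψ₀ x}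
    · rw [Set.indicator_of_notMem (by simpa using hx), zero_mul, Pi.zero_apply]
    · rw [h4 (le_antisymm (not_lt.1 fun h => hx (h2 n h)) h3), mul_zero, Pi.zero_apply]
  have h1 : ∀ v : N, inner ℝ h' (v : Lp ℝ 2 μ) = 0 := fun v =>
    (TopologicalSpace.denseRange_denseSeq N).induction_on
      (p := fun v : N => inner ℝ h' (v : Lp ℝ 2 μ) = 0) v
      (isClosed_eq (by fun_prop) continuous_const) h0
  have h2 : h' = 0 := inner_self_eq_zero.1 (h1 ⟨h', hh'⟩)
  filter_upwards [cip_indicator_self hA.compl (coeFn_indL (hm _ hA.compl) h),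
    (relOrthogonal m (fun _ : Unit => h')).zero_mem ()] with x h3 h4 hx
  rw [Set.indicator_of_mem hx, Pi.one_apply, one_mul] at h3
  rw [← h3]
  change cip m μ h' h' x = 0
  rw [show cip m μ h' h' x = cip m μ 0 h' x by rw [h2]]
  exact h4

variable (m) in
/-- The fibres of the module `M` have dimension less than `k`: no set of positive measure carries
`k` elements of `M` that are orthonormal in every fibre over it. -/
def RelDimLT (M : Submodule ℝ (Lp ℝ 2 μ)) (k : ℕ) : Prop :=
  ∀ ψ : Fin k → Lp ℝ 2 μ, (∀ i, ψ i ∈ M) → ∀ A : Set X, MeasurableSet[m] A →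
    (∀ i j, cip m μ (ψ i) (ψ j) =ᵐ[μ] if i = j then A.indicator 1 else 0) → μ A = 0

/-- Choosing `k` times in a row an element of full support in the orthogonal complement of the
previous ones. The fibres of `N` outside `A` are spanned by the chosen elements. -/
lemma IsRelModule.exists_orthonormal [SecondCountableTopology (Lp ℝ 2 μ)] (hm : m ≤ m0)
    {N : Submodule ℝ (Lp ℝ 2 μ)} (hN : IsRelModule m N) (k : ℕ) :
    ∃ ψ : Fin k → Lp ℝ 2 μ, (∀ i, ψ i ∈ N) ∧ IsRelOrthonormal m ψ ∧
      ∃ A : Set X, MeasurableSet[m] A ∧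
        (∀ i, ∀ᵐ x ∂μ, x ∈ A → cip m μ (ψ i) (ψ i) x = 1) ∧
        ∀ h ∈ N, h ∈ relOrthogonal m ψ → ∀ᵐ x ∂μ, x ∉ A → cip m μ h h x = 0 := by
  induction k with
  | zero =>
    exact ⟨Fin.elim0, fun i => i.elim0, ⟨fun i => i.elim0, fun i => i.elim0⟩, Set.univ,
      MeasurableSet.univ, fun i => i.elim0, fun h _ _ => ae_of_all _ fun x hx => by simp at hx⟩
  | succ k ih =>
    obtain ⟨ψ, hψN, hψ, A, hA, hA1, hA0⟩ := ih
    obtain ⟨p, hp, B, hB, hpp, hB0⟩ :=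
      (hN.inf (isRelModule_relOrthogonal hm ψ)).exists_full_support hm
    refine ⟨Fin.snoc ψ p, fun i => ?_, hψ.snoc hp.2 ⟨B, hB, hpp⟩, A ∩ B, hA.inter hB,
      fun i => ?_, fun h hh hhψ => ?_⟩
    · induction i using Fin.lastCases with
      | last =>
        rw [Fin.snoc_last]
        exact hp.1
      | cast i =>
        rw [Fin.snoc_castSucc]
        exact hψN i
    · induction i using Fin.lastCases with
      | last =>
        rw [Fin.snoc_last]
        filter_upwards [hpp] with x hx hxAB
        rw [hx, Set.indicator_of_mem hxAB.2, Pi.one_apply]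
      | cast i =>
        rw [Fin.snoc_castSucc]
        filter_upwards [hA1 i] with x hx hxAB using hx hxAB.1
    · have hh' : h ∈ relOrthogonal m ψ := fun j => by
        simpa only [Fin.snoc_castSucc] using hhψ j.castSucc
      filter_upwards [hA0 h hh hh', hB0 h ⟨hh, hh'⟩] with x h1 h2 hx
      by_cases hxA : x ∈ A
      · exact h2 fun hxB => hx ⟨hxA, hxB⟩
      · exact h1 hxA

/-- A closed submodule of a module with fibres of bounded dimension is finitely generated. -/
lemma IsRelModule.exists_generators [SecondCountableTopology (Lp ℝ 2 μ)] (hm : m ≤ m0)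
    {M N : Submodule ℝ (Lp ℝ 2 μ)} {k : ℕ} (hM : RelDimLT m M k) (hN : IsRelModule m N)
    (hNM : N ≤ M) :
    ∃ ψ : Fin k → Lp ℝ 2 μ, (∀ i, ψ i ∈ N) ∧ ∀ h ∈ N, h ∈ relOrthogonal m ψ → h = 0 := by
  obtain ⟨ψ, hψN, hψ, A, hA, hA1, hA0⟩ := hN.exists_orthonormal hm k
  have hμA : μ A = 0 := by
    refine hM (fun i => indL (hm A hA) (ψ i))
      (fun i => hNM (hN.indicator_mem A hA _ (hψN i) _ (coeFn_indL _ _))) A hA fun i j => ?_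
    by_cases hij : i = j
    · rw [if_pos hij, hij]
      filter_upwards [cip_indicator_self hA (coeFn_indL (hm A hA) (ψ j)), hA1 j] with x h1 h2
      rw [h1]
      by_cases hx : x ∈ A
      · rw [h2 hx, mul_one]
      · simp [hx]
    · rw [if_neg hij]
      filter_upwards [cip_indicator_left hA (coeFn_indL (hm A hA) (ψ i)) (indL (hm A hA) (ψ j)),
        cip_indicator_left hA (coeFn_indL (hm A hA) (ψ j)) (ψ i), hψ.orthogonal i j hij]
        with x h1 h2 h3
      rw [h1, cip_comm, h2, cip_comm, h3]
      simp
  refine ⟨ψ, hψN, fun h hh hhψ => eq_zero_of_cip_self hm ?_⟩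
  filter_upwards [hA0 h hh hhψ, measure_eq_zero_iff_ae_notMem.1 hμA] with x h1 h2 using h1 h2

end RelModule

/-! ### The Koopman operators -/

section Koopman

variable {G : Type*} [Group G] [MeasurableSpace G]
  {X : Type*} {m m0 : MeasurableSpace X} [MulAction G X] {μ : Measure X} [IsSystem G X μ]

lemma coeFn_koopman (g : G) (f : Lp ℝ 2 μ) : koopman μ g f =ᵐ[μ] fun x => f (g • x) :=
  Lp.coeFn_compMeasurePreserving f (IsSystem.measurePreserving g)

/-- The Koopman operator as a linear isometry. -/
noncomputable def koopmanLI (μ : Measure X) [IsSystem G X μ] (g : G) :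
    Lp ℝ 2 μ →ₗᵢ[ℝ] Lp ℝ 2 μ where
  toFun := koopman μ g
  map_add' u v := map_add (Lp.compMeasurePreserving _ _) u v
  map_smul' c u := by
    refine Lp.ext ?_
    filter_upwards [coeFn_koopman g (c • u), Lp.coeFn_smul c (koopman μ g u), coeFn_koopman g u,
      (IsSystem.measurePreserving (μ := μ) g).quasiMeasurePreserving.ae (Lp.coeFn_smul c u)]
      with x h1 h2 h3 h4
    rw [h1, RingHom.id_apply, h2, h4, Pi.smul_apply, Pi.smul_apply, h3]
  norm_map' u := Lp.norm_compMeasurePreserving u (IsSystem.measurePreserving g)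

lemma koopmanLI_apply (g : G) (f : Lp ℝ 2 μ) : koopmanLI μ g f = koopman μ g f := rfl

lemma koopman_koopman (s g : G) (f : Lp ℝ 2 μ) :
    koopman μ s (koopman μ g f) = koopman μ (g * s) f := by
  refine Lp.ext ?_
  filter_upwards [coeFn_koopman s (koopman μ g f), coeFn_koopman (g * s) f,
    (IsSystem.measurePreserving (μ := μ) s).quasiMeasurePreserving.ae (coeFn_koopman g f)]
    with x h1 h2 h3
  rw [h1, h2, h3, mul_smul]

lemma koopman_one (f : Lp ℝ 2 μ) : koopman μ (1 : G) f = f := by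
  refine Lp.ext ?_
  filter_upwards [coeFn_koopman (1 : G) f] with x h1
  rw [h1, one_smul]

lemma koopman_inv_koopman (g : G) (f : Lp ℝ 2 μ) : koopman μ g⁻¹ (koopman μ g f) = f := by
  rw [koopman_koopman, mul_inv_cancel, koopman_one]

lemma koopman_koopman_inv (g : G) (f : Lp ℝ 2 μ) : koopman μ g (koopman μ g⁻¹ f) = f := by
  rw [koopman_koopman, inv_mul_cancel, koopman_one]

lemma inner_koopman (g : G) (u v : Lp ℝ 2 μ) :
    inner ℝ (koopman μ g u) (koopman μ g v) = inner ℝ u v :=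
  (koopmanLI μ g).inner_map_map u v

lemma koopman_indicator (g : G) {S : Set X} {u w : Lp ℝ 2 μ} (hw : w =ᵐ[μ] S.indicator u) :
    koopman μ g w =ᵐ[μ] ((fun x => g • x) ⁻¹' S).indicator (koopman μ g u) := by
  filter_upwards [coeFn_koopman g w, coeFn_koopman g u,
    (IsSystem.measurePreserving (μ := μ) g).quasiMeasurePreserving.ae hw] with x h1 h2 h3
  rw [h1, h3]
  by_cases hx : g • x ∈ S
  · rw [Set.indicator_of_mem hx, Set.indicator_of_mem (by exact hx), h2]
  · rw [Set.indicator_of_notMem hx, Set.indicator_of_notMem (by exact hx)]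

lemma measurableEmbedding_smul_of_isSystem (μ : Measure X) [IsSystem G X μ] (g : G) :
    MeasurableEmbedding fun x : X => g • x :=
  MeasurableEquiv.measurableEmbedding
    { toEquiv := MulAction.toPerm g
      measurable_toFun := (IsSystem.measurePreserving (μ := μ) g).measurable
      measurable_invFun := (IsSystem.measurePreserving (μ := μ) g⁻¹).measurable }

/-- The conditional inner product over a factor is equivariant. -/
lemma cip_koopman (hm : m ≤ m0) (hinv : ∀ g : G, Measurable[m, m] fun x : X => g • x) (g : G)
    (u v : Lp ℝ 2 μ) :
    cip m μ (koopman μ g u) (koopman μ g v) =ᵐ[μ] fun x => cip m μ u v (g • x) := by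
  have : IsProbabilityMeasure μ := IsSystem.isProbabilityMeasure G
  have hg := IsSystem.measurePreserving (μ := μ) g
  have hge := measurableEmbedding_smul_of_isSystem μ g
  refine (ae_eq_condExp_of_forall_setIntegral_eq hm (integrable_coe_mul _ _)
    (fun S _ _ => ((hg.integrable_comp_emb hge).2 (integrable_cip u v)).integrableOn)
    (fun S hS _ => ?_)
    ((stronglyMeasurable_cip u v).comp_measurable (hinv g)).aestronglyMeasurable).symm
  have hS' : (fun x : X => g • x) ⁻¹' ((fun x => g⁻¹ • x) ⁻¹' S) = S := by
    ext x
    simp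
  simp only [Function.comp_apply]
  rw [← hS', hg.setIntegral_preimage_emb hge (fun x => cip m μ u v x), cip,
    setIntegral_condExp hm (integrable_coe_mul u v) (hinv g⁻¹ hS),
    ← hg.setIntegral_preimage_emb hge (fun x => u x * v x), hS']
  refine setIntegral_congr_ae (hm S hS) ?_
  filter_upwards [coeFn_koopman g u, coeFn_koopman g v] with x h1 h2 _
  rw [h1, h2]

omit [IsSystem G X μ] in
/-- A jointly measurable measure-preserving action of a second-countable locally compact group acts
continuously on `L²`. Countably many small balls cover `L²`, so that the orbit map sends a set of
positive Haar measure into one of them, and Steinhaus' theorem gives continuity at `1`. -/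
lemma continuous_koopman [TopologicalSpace G] [IsTopologicalGroup G] [T2Space G]
    [LocallyCompactSpace G] [SecondCountableTopology G] [BorelSpace G] (μ : Measure X)
    [IsSystem G X μ] (u : Lp ℝ 2 μ) : Continuous fun g : G => koopman μ g u := by
  have : IsProbabilityMeasure μ := IsSystem.isProbabilityMeasure G
  have : MeasurableSpace.CountablyGenerated X := IsSystem.countablyGenerated G μ
  have : Fact ((2 : ℝ≥0∞) ≠ ∞) := ⟨by norm_num⟩
  have hmeas : ∀ v : Lp ℝ 2 μ, Measurable fun g : G => ‖koopman μ g u - v‖ := by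
    intro v
    have h1 : ∀ g : G, ‖koopman μ g u - v‖ = √(∫ x, (u (g • x) - v x) ^ 2 ∂μ) := by
      intro g
      rw [← Real.sqrt_sq (norm_nonneg _), ← real_inner_self_eq_norm_sq, inner_eq_integral]
      congr 1
      refine integral_congr_ae ?_
      filter_upwards [Lp.coeFn_sub (koopman μ g u) v, coeFn_koopman g u] with x h2 h3
      rw [h2, Pi.sub_apply, h3, pow_two]
    simp_rw [h1]
    refine Measurable.sqrt (StronglyMeasurable.measurable
      (StronglyMeasurable.integral_prod_right (f := fun (g : G) (x : X) => (u (g • x) - v x) ^ 2)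
        ?_))
    exact ((((Lp.stronglyMeasurable u).measurable.comp (IsSystem.measurable_action μ)).sub
      ((Lp.stronglyMeasurable v).measurable.comp measurable_snd)).pow_const 2).stronglyMeasurable
  have hone : ∀ ε > 0, ∀ᶠ s in 𝓝 (1 : G), ‖koopman μ s u - u‖ < ε := by
    intro ε hε
    set d := TopologicalSpace.denseSeq (Lp ℝ 2 μ)
    set A : ℕ → Set G := fun n => {g | ‖koopman μ g u - d n‖ < ε / 2}
    have hA : ∀ n, MeasurableSet (A n) := fun n => measurableSet_lt (hmeas _) measurable_const
    have hU : ⋃ n, A n = Set.univ := Set.eq_univ_of_forall fun g => by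
      obtain ⟨n, hn⟩ := (TopologicalSpace.denseRange_denseSeq (Lp ℝ 2 μ)).exists_dist_lt
        (koopman μ g u) (half_pos hε)
      exact Set.mem_iUnion.2 ⟨n, by rwa [dist_eq_norm] at hn⟩
    obtain ⟨n, hn⟩ : ∃ n, 0 < (Measure.haar : Measure G) (A n) := by
      refine exists_measure_pos_of_not_measure_iUnion_null ?_
      rw [hU]
      exact NeZero.ne _
    filter_upwards [Measure.div_mem_nhds_one_of_haar_pos _ (A n) (hA n) hn] with s hs
    obtain ⟨a, ha, b, hb, rfl⟩ := hs
    have h1 : koopman μ (a / b) u - u = koopmanLI μ b⁻¹ (koopman μ a u - koopman μ b u) := by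
      rw [map_sub, koopmanLI_apply, koopmanLI_apply, koopman_koopman, koopman_inv_koopman,
        div_eq_mul_inv]
    rw [h1, LinearIsometry.norm_map]
    have h2 : ‖koopman μ a u - d n‖ < ε / 2 := ha
    have h3 : ‖koopman μ b u - d n‖ < ε / 2 := hb
    have h4 := norm_sub_le (koopman μ a u - d n) (koopman μ b u - d n)
    rw [sub_sub_sub_cancel_right] at h4
    linarith
  refine continuous_iff_continuousAt.2 fun g₀ => Metric.tendsto_nhds.2 fun ε hε => ?_
  have ht : Tendsto (fun g => g * g₀⁻¹) (𝓝 g₀) (𝓝 1) := by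
    have := (continuous_mul_const g₀⁻¹).tendsto g₀
    rwa [mul_inv_cancel] at this
  filter_upwards [ht.eventually (hone ε hε)] with g hg
  have h1 : koopman μ g u - koopman μ g₀ u =
      koopmanLI μ g₀ (koopman μ (g * g₀⁻¹) u - u) := by
    rw [map_sub, koopmanLI_apply, koopmanLI_apply, koopman_koopman, inv_mul_cancel_right]
  rwa [dist_eq_norm, h1, LinearIsometry.norm_map]

end Koopman

/-! ### Averaging operators over an amenable group -/

section Mean

variable {G : Type*} [Group G] [TopologicalSpace G] [IsTopologicalGroup G]

/-- A left-invariant mean on the bounded continuous functions on `G`. -/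
structure IsInvariantMean (L : (G →ᵇ ℝ) →ₗ[ℝ] ℝ) : Prop where
  nonneg : ∀ φ : G →ᵇ ℝ, (∀ x, 0 ≤ φ x) → 0 ≤ L φ
  map_one : L (BoundedContinuousFunction.const G 1) = 1
  invariant : ∀ (g : G) (φ : G →ᵇ ℝ), L (φ.compContinuous (ContinuousMap.mulLeft g)) = L φ

lemma IsInvariantMean.map_const {L : (G →ᵇ ℝ) →ₗ[ℝ] ℝ} (hL : IsInvariantMean L) (c : ℝ) :
    L (BoundedContinuousFunction.const G c) = c := by
  have : BoundedContinuousFunction.const G c = c • BoundedContinuousFunction.const G (1 : ℝ) := by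
    ext
    simp
  rw [this, map_smul, hL.map_one, smul_eq_mul, mul_one]

lemma IsInvariantMean.le_of_forall_le {L : (G →ᵇ ℝ) →ₗ[ℝ] ℝ} (hL : IsInvariantMean L)
    {φ : G →ᵇ ℝ} {c : ℝ} (h : ∀ x, φ x ≤ c) : L φ ≤ c := by
  have := hL.nonneg (BoundedContinuousFunction.const G c - φ) fun x => by simpa using h x
  rw [map_sub, hL.map_const] at this
  linarith

lemma IsInvariantMean.le_of_forall_ge {L : (G →ᵇ ℝ) →ₗ[ℝ] ℝ} (hL : IsInvariantMean L)
    {φ : G →ᵇ ℝ} {c : ℝ} (h : ∀ x, c ≤ φ x) : c ≤ L φ := by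
  have := hL.nonneg (φ - BoundedContinuousFunction.const G c) fun x => by simpa using h x
  rw [map_sub, hL.map_const] at this
  linarith

end Mean

section Coefficient

variable {X : Type*} {m m0 : MeasurableSpace X} {μ : Measure X} [IsProbabilityMeasure μ]

/-- Bessel's inequality in almost every fibre. -/
lemma IsRelOrthonormal.sum_sq_le (hm : m ≤ m0) {ι : Type*} [Fintype ι] {ψ : ι → Lp ℝ 2 μ}
    (h : IsRelOrthonormal m ψ) (u : Lp ℝ 2 μ) :
    ∀ᵐ x ∂μ, ∑ i, cip m μ u (ψ i) x ^ 2 ≤ cip m μ u u x := by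
  obtain ⟨w, hw, hwc, hmem⟩ := h.exists_proj hm u
  filter_upwards [hwc u, hwc (u - w), ae_all_iff.2 hmem, cip_sub_left (m := m) u w (u - w),
    cip_sub_left (m := m) u w u, cip_self_nonneg (m := m) (u - w)] with x h1 h2 h3 h4 h5 h6
  rw [h4, Pi.sub_apply, h2, Finset.sum_eq_zero fun i _ => by
    rw [cip_comm (ψ i), h3 i, Pi.zero_apply, mul_zero], cip_comm, h5, Pi.sub_apply, h1] at h6
  have : ∑ i, cip m μ u (ψ i) x * cip m μ (ψ i) u x = ∑ i, cip m μ u (ψ i) x ^ 2 :=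
    Finset.sum_congr rfl fun i _ => by rw [cip_comm (ψ i), pow_two]
  linarith

omit [IsProbabilityMeasure μ] in
lemma cip_sq_le_of_bound {h : Lp ℝ 2 μ} {C : ℝ} (hC : ∀ᵐ x ∂μ, cip m μ h h x ≤ C) (u : Lp ℝ 2 μ) :
    ∀ᵐ x ∂μ, cip m μ h u x ^ 2 ≤ C * cip m μ u u x := by
  filter_upwards [hC, cip_sq_le (m := m) h u, cip_self_nonneg (m := m) u] with x h1 h2 h3
  exact h2.trans (mul_le_mul_of_nonneg_right h1 h3)

omit [IsProbabilityMeasure μ] in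
lemma memLp_cip (hm : m ≤ m0) {h : Lp ℝ 2 μ} {C : ℝ} (hC : ∀ᵐ x ∂μ, cip m μ h h x ≤ C)
    (u : Lp ℝ 2 μ) : MemLp (cip m μ h u) 2 μ := by
  have hs : AEStronglyMeasurable (cip m μ h u) μ :=
    ((stronglyMeasurable_cip h u).mono hm).aestronglyMeasurable
  rw [memLp_two_iff_integrable_sq hs]
  refine ((integrable_cip (m := m) u u).const_mul C).mono' (hs.pow 2) ?_
  filter_upwards [cip_sq_le_of_bound hC u] with x hx
  rwa [Real.norm_of_nonneg (sq_nonneg _)]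

/-- The operator `u ↦ E(h u | m)`, for `h` with essentially bounded fibre norms. -/
noncomputable def coefL (hm : m ≤ m0) {h : Lp ℝ 2 μ} {C : ℝ} (hC : ∀ᵐ x ∂μ, cip m μ h h x ≤ C) :
    Lp ℝ 2 μ →L[ℝ] Lp ℝ 2 μ :=
  LinearMap.mkContinuous
    { toFun := fun u => (memLp_cip hm hC u).toLp
      map_add' := fun u v => by
        rw [← MemLp.toLp_add]
        refine MemLp.toLp_congr _ _ ?_
        simpa only [cip_comm h] using cip_add_left u v h
      map_smul' := fun c u => by
        rw [RingHom.id_apply, ← MemLp.toLp_const_smul]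
        refine MemLp.toLp_congr _ _ ?_
        simpa only [cip_comm h] using cip_smul_left c u h } (√C)
    fun u => by
      rw [LinearMap.coe_mk, AddHom.coe_mk]
      have hC0 : 0 ≤ C := by
        obtain ⟨x, h1, h2⟩ := (hC.and (cip_self_nonneg (m := m) h)).exists
        exact h2.trans h1
      refine abs_le_of_sq_le_sq' ?_ (by positivity) |>.2
      rw [mul_pow, Real.sq_sqrt hC0, ← real_inner_self_eq_norm_sq, inner_eq_integral,
        ← integral_cip_self hm u, ← integral_const_mul]
      refine integral_mono_ae (integrable_coe_mul _ _) ((integrable_cip u u).const_mul C) ?_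
      filter_upwards [(memLp_cip hm hC u).coeFn_toLp, cip_sq_le_of_bound hC u] with x h1 h2
      rwa [h1, ← pow_two]

lemma coeFn_coefL (hm : m ≤ m0) {h : Lp ℝ 2 μ} {C : ℝ} (hC : ∀ᵐ x ∂μ, cip m μ h h x ≤ C)
    (u : Lp ℝ 2 μ) : coefL hm hC u =ᵐ[μ] cip m μ h u := by
  have h : coefL hm hC u = (memLp_cip hm hC u).toLp := by rfl
  rw [h]
  exact MemLp.coeFn_toLp _

lemma inner_coefL (hm : m ≤ m0) {h : Lp ℝ 2 μ} {C : ℝ} (hC : ∀ᵐ x ∂μ, cip m μ h h x ≤ C)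
    (u v : Lp ℝ 2 μ) :
    inner ℝ (coefL hm hC u) (coefL hm hC v) = ∫ x, cip m μ h u x * cip m μ h v x ∂μ := by
  rw [inner_eq_integral]
  refine integral_congr_ae ?_
  filter_upwards [coeFn_coefL hm hC u, coeFn_coefL hm hC v] with x h1 h2
  rw [h1, h2]

lemma coefL_indL (hm : m ≤ m0) {h : Lp ℝ 2 μ} {C : ℝ} (hC : ∀ᵐ x ∂μ, cip m μ h h x ≤ C)
    {S : Set X} (hS : MeasurableSet[m] S) {u w : Lp ℝ 2 μ} (hw : w =ᵐ[μ] S.indicator u) :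
    coefL hm hC w = indL (hm S hS) (coefL hm hC u) := by
  refine Lp.ext ?_
  filter_upwards [coeFn_coefL hm hC w, coeFn_coefL hm hC u,
    coeFn_indL (hm S hS) (coefL hm hC u), cip_indicator_left hS hw h] with x h1 h2 h3 h4
  rw [h1, h3, cip_comm, h4]
  by_cases hx : x ∈ S
  · rw [Set.indicator_of_mem hx, Set.indicator_of_mem hx, h2, cip_comm, Pi.one_apply, one_mul]
  · rw [Set.indicator_of_notMem hx, Set.indicator_of_notMem hx, zero_mul]

end Coefficient

section Average

variable {G : Type*} [Group G] [TopologicalSpace G] [IsTopologicalGroup G] [T2Space G]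
  [LocallyCompactSpace G] [SecondCountableTopology G] [MeasurableSpace G] [BorelSpace G]
  {X : Type*} {m m0 : MeasurableSpace X} [MulAction G X] {μ : Measure X} [IsSystem G X μ]

variable (G) in
/-- The function `g ↦ ⟨Θ T^g u, Θ T^g v⟩` on `G`. -/
noncomputable def orbitForm (Θ : Lp ℝ 2 μ →L[ℝ] Lp ℝ 2 μ) (u v : Lp ℝ 2 μ) : G →ᵇ ℝ :=
  BoundedContinuousFunction.ofNormedAddCommGroup
    (fun g => inner ℝ (Θ (koopman μ g u)) (Θ (koopman μ g v)))
    ((Θ.continuous.comp (continuous_koopman μ u)).inner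
      (Θ.continuous.comp (continuous_koopman μ v)))
    (‖Θ‖ ^ 2 * ‖u‖ * ‖v‖) fun g => by
      refine (norm_inner_le_norm _ _).trans ?_
      have h1 := Θ.le_opNorm (koopmanLI μ g u)
      have h2 := Θ.le_opNorm (koopmanLI μ g v)
      rw [LinearIsometry.norm_map] at h1 h2
      calc _ ≤ (‖Θ‖ * ‖u‖) * (‖Θ‖ * ‖v‖) :=
            mul_le_mul h1 h2 (norm_nonneg _) (by positivity)
        _ = _ := by ring

lemma orbitForm_apply (Θ : Lp ℝ 2 μ →L[ℝ] Lp ℝ 2 μ) (u v : Lp ℝ 2 μ) (g : G) :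
    orbitForm G Θ u v g = inner ℝ (Θ (koopman μ g u)) (Θ (koopman μ g v)) := rfl

lemma abs_orbitForm_le (Θ : Lp ℝ 2 μ →L[ℝ] Lp ℝ 2 μ) (u v : Lp ℝ 2 μ) (g : G) :
    |orbitForm G Θ u v g| ≤ ‖Θ‖ ^ 2 * ‖u‖ * ‖v‖ := by
  refine (orbitForm G Θ u v).norm_coe_le_norm g |>.trans ?_
  exact BoundedContinuousFunction.norm_ofNormedAddCommGroup_le _ (by positivity) _

/-- The average over `G` of the operators `(T^g)* Θ* Θ T^g`. -/
lemma exists_average {L : (G →ᵇ ℝ) →ₗ[ℝ] ℝ} (hL : IsInvariantMean L)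
    (Θ : Lp ℝ 2 μ →L[ℝ] Lp ℝ 2 μ) :
    ∃ K : Lp ℝ 2 μ →L[ℝ] Lp ℝ 2 μ, ∀ u v, inner ℝ (K u) v = L (orbitForm G Θ u v) := by
  have hadd : ∀ u u' v, L (orbitForm G Θ (u + u') v) =
      L (orbitForm G Θ u v) + L (orbitForm G Θ u' v) := fun u u' v => by
    rw [← map_add]
    congr 1
    ext g
    simp only [BoundedContinuousFunction.add_apply, orbitForm_apply, ← koopmanLI_apply, map_add,
      inner_add_left]
  have hsmul : ∀ (c : ℝ) u v, L (orbitForm G Θ (c • u) v) = c • L (orbitForm G Θ u v) :=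
    fun c u v => by
      rw [← map_smul]
      congr 1
      ext g
      simp only [BoundedContinuousFunction.smul_apply, orbitForm_apply, ← koopmanLI_apply,
        map_smul, inner_smul_left, conj_trivial, smul_eq_mul]
  have hcomm : ∀ u v, orbitForm G Θ u v = orbitForm G Θ v u := fun u v => by
    ext g
    simp only [orbitForm_apply, real_inner_comm]
  let B : Lp ℝ 2 μ →L⋆[ℝ] Lp ℝ 2 μ →L[ℝ] ℝ :=
    LinearMap.mkContinuous₂ (LinearMap.mk₂'ₛₗ (starRingEnd ℝ) (RingHom.id ℝ)
      (fun u v => L (orbitForm G Θ u v)) hadd hsmul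
      (fun u v v' => by rw [hcomm, hadd, hcomm u, hcomm u])
      (fun c u v => by rw [hcomm, hsmul, hcomm, RingHom.id_apply])) (‖Θ‖ ^ 2) fun u v => by
        rw [LinearMap.mk₂'ₛₗ_apply, Real.norm_eq_abs, abs_le]
        exact ⟨hL.le_of_forall_ge fun g => (abs_le.1 (abs_orbitForm_le Θ u v g)).1,
          hL.le_of_forall_le fun g => (abs_le.1 (abs_orbitForm_le Θ u v g)).2⟩
  exact ⟨InnerProductSpace.continuousLinearMapOfBilin B,
    fun u v => InnerProductSpace.continuousLinearMapOfBilin_apply B u v⟩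

variable (G m μ) in
/-- `f` lies in a `G`-invariant closed module whose fibres have bounded dimension. -/
def InFiniteModule (f : Lp ℝ 2 μ) : Prop :=
  ∃ M : Submodule ℝ (Lp ℝ 2 μ), IsRelModule m M ∧ (∀ (g : G), ∀ u ∈ M, koopman μ g u ∈ M) ∧
    (∃ k, RelDimLT m M k) ∧ f ∈ M

/-- If `h` is orthogonal to all invariant closed modules with fibres of bounded dimension, then the
coefficients `E(h T^g u | m)` tend to `0` on average. -/
lemma mean_orbitForm_eq_zero {L : (G →ᵇ ℝ) →ₗ[ℝ] ℝ} (hL : IsInvariantMean L) (hm : m ≤ m0)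
    (hinv : ∀ g : G, Measurable[m, m] fun x : X => g • x) [IsProbabilityMeasure μ]
    {h : Lp ℝ 2 μ} {C : ℝ} (hC : ∀ᵐ x ∂μ, cip m μ h h x ≤ C)
    (hort : ∀ f : Lp ℝ 2 μ, InFiniteModule G m μ f → inner ℝ f h = 0) (u : Lp ℝ 2 μ) :
    L (orbitForm G (coefL hm hC) u u) = 0 := by
  set Θ := coefL hm hC
  obtain ⟨K, hK⟩ := exists_average hL Θ
  have hKs : ∀ u v, inner ℝ (K u) v = inner ℝ u (K v) := fun u v => by
    rw [real_inner_comm (K v), hK, hK]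
    congr 1
    ext g
    simp only [orbitForm_apply, real_inner_comm]
  -- `K` vanishes on every finite module, since `h` is orthogonal to it in almost every fibre.
  have hK0 : ∀ f, InFiniteModule G m μ f → K f = 0 := by
    rintro f ⟨M, hM, hMG, hMk, hf⟩
    have hh : h ∈ Mᗮ := (Submodule.mem_orthogonal _ _).2 fun w hw => hort w ⟨M, hM, hMG, hMk, hw⟩
    have hz : ∀ g : G, Θ (koopman μ g f) = 0 := fun g => by
      refine Lp.ext ?_
      filter_upwards [coeFn_coefL hm hC (koopman μ g f), hM.cip_eq_zero hm (hMG g f hf) hh,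
        Lp.coeFn_zero ℝ 2 μ] with x h1 h2 h3
      rw [h1, cip_comm, h2, h3]
    refine ext_inner_right ℝ fun v => ?_
    rw [hK, inner_zero_left, ← map_zero L]
    congr 1
    ext g
    rw [orbitForm_apply, hz, inner_zero_left]
    rfl
  have hKG : ∀ (s : G) u, K (koopman μ s u) = koopman μ s (K u) := fun s u => by
    refine ext_inner_right ℝ fun v => ?_
    obtain ⟨w, rfl⟩ : ∃ w, koopman μ s w = v := ⟨_, koopman_koopman_inv s v⟩
    rw [inner_koopman, hK, hK, ← hL.invariant s (orbitForm G Θ u w)]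
    congr 1
    ext g
    simp only [orbitForm_apply, koopman_koopman, BoundedContinuousFunction.compContinuous_apply,
      ContinuousMap.coe_mulLeft]
  have hKS : ∀ (S : Set X) (hS : MeasurableSet[m] S) u,
      K (indL (hm S hS) u) = indL (hm S hS) (K u) := fun S hS u => by
    refine ext_inner_right ℝ fun v => ?_
    rw [inner_indL_comm, hK, hK]
    congr 1
    ext g
    rw [orbitForm_apply, orbitForm_apply,
      coefL_indL hm hC (hinv g hS) (koopman_indicator g (coeFn_indL (hm S hS) u)),
      coefL_indL hm hC (hinv g hS) (koopman_indicator g (coeFn_indL (hm S hS) v)),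
      inner_indL_comm]
  have hle : ∀ c > 0, inner ℝ (K u) u ≤ c * ‖u‖ ^ 2 := by
    intro c hc
    set A : Lp ℝ 2 μ →L[ℝ] Lp ℝ 2 μ := K - c • 1
    have hAC : ∀ D : Lp ℝ 2 μ →L[ℝ] Lp ℝ 2 μ, (∀ u, K (D u) = D (K u)) → Commute A D :=
      fun D hD => Commute.sub_left (ContinuousLinearMap.ext hD) ((Commute.one_left D).smul_left c)
    have hAi : ∀ u v, inner ℝ (A u) v = inner ℝ (K u) v - c * inner ℝ u v := fun u v => by
      simp [A, inner_sub_left, inner_smul_left]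
    obtain ⟨P, hP0, hPC, hPA⟩ := exists_posPart_of_symmetric A fun u v => by
      rw [real_inner_comm (A v) u, hAi, hAi, hKs, real_inner_comm (K v) u, real_inner_comm v u]
    set M := P.range.topologicalClosure
    have hM : IsRelModule m M := by
      refine isRelModule_topologicalClosure hm _ ?_
      rintro S hS _ ⟨v, rfl⟩ w hw
      refine ⟨indL (hm S hS) v, ?_⟩
      have h1 : w = indL (hm S hS) (P v) := Lp.ext (hw.trans (coeFn_indL _ _).symm)
      rw [h1]
      exact DFunLike.congr_fun (hPC _ (hAC _ fun u => hKS S hS u)).eq v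
    have hMG : ∀ (g : G), ∀ u ∈ M, koopman μ g u ∈ M := by
      intro g u hu
      refine map_mem_closure (koopmanLI μ g).continuous hu ?_
      rintro _ ⟨v, rfl⟩
      exact ⟨koopman μ g v, DFunLike.congr_fun
        (hPC (koopmanLI μ g).toContinuousLinearMap (hAC _ fun u => hKG g u)).eq v⟩
    have hMc : ∀ v ∈ M, c * ‖v‖ ^ 2 ≤ inner ℝ (K v) v := by
      intro v hv
      refine closure_minimal (t := {v | c * ‖v‖ ^ 2 ≤ inner ℝ (K v) v}) ?_
        (isClosed_le (by fun_prop) (by fun_prop)) hv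
      rintro _ ⟨w, rfl⟩
      have := hP0 w
      rw [hAi, real_inner_self_eq_norm_sq] at this
      exact sub_nonneg.1 this
    obtain ⟨k, hk⟩ := exists_nat_gt (C / c)
    -- Bessel's inequality bounds the trace of `K` over a set `S` by `C μ(S)`.
    have hMk : RelDimLT m M k := by
      intro ψ hψM S hS hψ
      have hψS : ∀ i, ‖ψ i‖ ^ 2 = μ.real S := fun i => by
        rw [← integral_cip_self hm, integral_congr_ae (hψ i i), if_pos rfl,
          integral_indicator_one (hm S hS)]
      have h1 : (k : ℝ) * (c * μ.real S) ≤ ∑ i, inner ℝ (K (ψ i)) (ψ i) := by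
        have : (k : ℝ) * (c * μ.real S) = ∑ _i : Fin k, c * μ.real S := by simp
        rw [this]
        exact Finset.sum_le_sum fun i _ => by
          rw [← hψS i]
          exact hMc _ (hψM i)
      have h2 : ∑ i, inner ℝ (K (ψ i)) (ψ i) ≤ C * μ.real S := by
        simp only [hK]
        rw [← map_sum]
        refine hL.le_of_forall_le fun g => ?_
        rw [BoundedContinuousFunction.coe_sum, Finset.sum_apply]
        set T : Set X := (fun x => g • x) ⁻¹' S
        have hT : MeasurableSet[m] T := hinv g hS
        have hTS : μ.real T = μ.real S :=
          (IsSystem.measurePreserving (μ := μ) g).measureReal_preimage (hm S hS).nullMeasurableSet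
        have hχ : ∀ i j, cip m μ (koopman μ g (ψ i)) (koopman μ g (ψ j)) =ᵐ[μ]
            if i = j then T.indicator 1 else 0 := fun i j => by
          filter_upwards [cip_koopman hm hinv g (ψ i) (ψ j),
            (IsSystem.measurePreserving (μ := μ) g).quasiMeasurePreserving.ae (hψ i j)]
            with x h1 h2
          rw [h1, h2]
          split_ifs <;> rfl
        have hro : IsRelOrthonormal m fun i => koopman μ g (ψ i) :=
          ⟨fun i j hij => by simpa only [if_neg hij] using hχ i j,
            fun i => ⟨T, hT, by simpa only [if_pos] using hχ i i⟩⟩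
        simp only [orbitForm_apply, Θ, inner_coefL]
        have hint : ∀ i, Integrable (fun x => cip m μ h (koopman μ g (ψ i)) x *
            cip m μ h (koopman μ g (ψ i)) x) μ := fun i =>
          (memLp_cip hm hC _).integrable_mul (memLp_cip hm hC _)
        rw [← integral_finsetSum _ fun i _ => hint i, ← hTS, ← integral_indicator_one (hm T hT),
          ← integral_const_mul]
        refine integral_mono_ae (integrable_finsetSum _ fun i _ => hint i)
          (((integrable_const (1 : ℝ)).indicator (hm T hT)).const_mul C) ?_
        filter_upwards [hC, hro.sum_sq_le hm h, ae_all_iff.2 fun i => hχ i i,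
          ae_all_iff.2 fun i => cip_eq_zero_of_self (m := m) (koopman μ g (ψ i)) h]
          with x hx1 hx2 hx3 hx4
        simp only [← pow_two]
        by_cases hx : x ∈ T
        · rw [Set.indicator_of_mem hx, Pi.one_apply, mul_one]
          exact hx2.trans hx1
        · rw [Set.indicator_of_notMem hx, mul_zero, Finset.sum_eq_zero fun i _ => ?_]
          rw [hx4 i (by rw [hx3 i, if_pos rfl, Set.indicator_of_notMem hx])]
          simp
      have h3 : (k : ℝ) * c * μ.real S ≤ C * μ.real S := by linarith
      have h4 : C < k * c := (div_lt_iff₀ hc).1 hk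
      have h5 : μ.real S = 0 := by
        by_contra hne
        have := lt_of_le_of_ne measureReal_nonneg (Ne.symm hne)
        nlinarith
      exact (measureReal_eq_zero_iff).1 h5
    have hP : P = 0 := by
      ext1 v
      have hv : P v ∈ M := P.range.le_topologicalClosure ⟨v, rfl⟩
      have h1 := hMc _ hv
      rw [hK0 _ ⟨M, hM, hMG, ⟨k, hMk⟩, hv⟩, inner_zero_left] at h1
      have h2 : ‖P v‖ ^ 2 = 0 := le_antisymm (by nlinarith) (sq_nonneg _)
      simpa using h2
    have := hPA hP u
    rw [hAi, real_inner_self_eq_norm_sq] at this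
    linarith
  rw [← hK]
  refine le_antisymm (le_of_forall_pos_le_add fun ε hε => ?_) ?_
  · refine (hle (ε / (‖u‖ ^ 2 + 1)) (by positivity)).trans ?_
    rw [zero_add, div_mul_eq_mul_div, div_le_iff₀ (by positivity)]
    gcongr
    linarith
  · rw [hK]
    refine hL.nonneg _ fun g => ?_
    rw [orbitForm_apply]
    exact real_inner_self_nonneg

end Average

/-! ### Modules generated over the factor -/

section ModuleSpan

variable {X : Type*} [MeasurableSpace X] {Y : Type*} [MeasurableSpace Y] {μ : Measure X}
  {ν : Measure Y} {π : X → Y}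

lemma subset_moduleSpan (S : Set (Lp ℝ 2 μ)) [IsFiniteMeasure ν] :
    S ⊆ moduleSpan μ ν π S := fun s hs =>
  Submodule.subset_span ⟨fun _ => 1, memLp_const 1, s, hs, ae_of_all _ fun x => by simp⟩

lemma moduleSpan_le (hπ : MeasurePreserving π μ ν) [IsProbabilityMeasure μ]
    {S : Set (Lp ℝ 2 μ)} {M : Submodule ℝ (Lp ℝ 2 μ)}
    (hM : IsRelModule (MeasurableSpace.comap π inferInstance) M) (hS : S ⊆ M) :
    moduleSpan μ ν π S ≤ M := by
  refine Submodule.span_le.2 ?_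
  rintro h ⟨α, hα, s, hs, hh⟩
  refine hM.mem_of_mul hπ.measurable.comap_le (a := fun x => hα.1.mk α (π x))
    (hα.1.stronglyMeasurable_mk.comp_measurable (comap_measurable π)) (hS hs) ?_
  filter_upwards [hh, hπ.quasiMeasurePreserving.ae hα.1.ae_eq_mk] with x h1 h2
  rw [h1, h2]

lemma isRelModule_closure_moduleSpan (hπ : Measurable π) (S : Set (Lp ℝ 2 μ)) :
    IsRelModule (MeasurableSpace.comap π inferInstance)
      (moduleSpan μ ν π S).topologicalClosure := by
  refine isRelModule_topologicalClosure hπ.comap_le _ ?_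
  rintro _ ⟨E, hE, rfl⟩ u hu w hw
  have h1 : w = indL (hπ hE) u := Lp.ext (hw.trans (coeFn_indL _ u).symm)
  have h2 : moduleSpan μ ν π S ≤
      (moduleSpan μ ν π S).comap (indL (μ := μ) (hπ hE)).toLinearMap := by
    refine Submodule.span_le.2 ?_
    rintro h ⟨α, hα, s, hs, hh⟩
    refine Submodule.subset_span ⟨E.indicator α, hα.indicator hE, s, hs, ?_⟩
    filter_upwards [hh, coeFn_indL (hπ hE) h] with x h3 h4
    refine h4.trans ?_
    by_cases hx : π x ∈ E
    · rw [Set.indicator_of_mem (by exact hx), Set.indicator_of_mem hx, h3]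
    · rw [Set.indicator_of_notMem (by exact hx), Set.indicator_of_notMem hx, zero_mul]
  rw [h1]
  exact h2 hu

lemma combinations_eq_moduleSpan (hπ : MeasurePreserving π μ ν) {d : ℕ} (φ : Fin d → Lp ℝ 2 μ) :
    combinations μ ν π φ = moduleSpan μ ν π (Set.range φ) := by
  refine Set.Subset.antisymm ?_ fun h hh => ?_
  · rintro h ⟨α, hα, hh⟩
    have hL : ∀ i, MemLp (fun x => α i (π x) * φ i x) 2 μ := fun i =>
      (Lp.memLp (φ i)).mul ((hα i).comp_measurePreserving hπ)
    have h1 : h = ∑ i, (hL i).toLp := by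
      refine Lp.ext ?_
      have h2 : ∀ s : Finset (Fin d), (∑ i ∈ s, (hL i).toLp : Lp ℝ 2 μ) =ᵐ[μ]
          fun x => ∑ i ∈ s, α i (π x) * φ i x := by
        intro s
        induction s using Finset.induction_on with
        | empty =>
          filter_upwards [Lp.coeFn_zero ℝ 2 μ] with x hx
          rw [Finset.sum_empty, Finset.sum_empty, hx, Pi.zero_apply]
        | insert i s hi ih =>
          rw [Finset.sum_insert hi]
          filter_upwards [ih, Lp.coeFn_add (hL i).toLp (∑ i ∈ s, (hL i).toLp),
            (hL i).coeFn_toLp] with x h1 h2 h3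
          rw [h2, Pi.add_apply, h1, h3, Finset.sum_insert hi]
      exact hh.trans (h2 Finset.univ).symm
    rw [h1]
    exact Submodule.sum_mem _ fun i _ =>
      Submodule.subset_span ⟨α i, hα i, φ i, ⟨i, rfl⟩, (hL i).coeFn_toLp⟩
  · induction hh using Submodule.span_induction with
    | mem h hh =>
      obtain ⟨α, hα, _, ⟨i, rfl⟩, hh⟩ := hh
      refine ⟨fun j => if j = i then α else 0, fun j => ?_, ?_⟩
      · dsimp only
        split_ifs
        exacts [hα, MemLp.zero]
      · filter_upwards [hh] with x hx
        rw [hx, Finset.sum_eq_single i (fun j _ hj => by simp [hj])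
          (fun hi => absurd (Finset.mem_univ i) hi), if_pos rfl]
    | zero => exact ⟨fun _ => 0, fun _ => MemLp.zero, by
      filter_upwards [Lp.coeFn_zero ℝ 2 μ] with x hx
      rw [hx]
      simp⟩
    | add u v _ _ hu hv =>
      obtain ⟨α, hα, hu⟩ := hu
      obtain ⟨β, hβ, hv⟩ := hv
      refine ⟨α + β, fun i => (hα i).add (hβ i), ?_⟩
      filter_upwards [Lp.coeFn_add u v, hu, hv] with x h1 h2 h3
      rw [h1, Pi.add_apply, h2, h3, ← Finset.sum_add_distrib]
      exact Finset.sum_congr rfl fun i _ => (add_mul _ _ _).symm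
    | smul c u _ hu =>
      obtain ⟨α, hα, hu⟩ := hu
      refine ⟨c • α, fun i => (hα i).const_smul c, ?_⟩
      filter_upwards [Lp.coeFn_smul c u, hu] with x h1 h2
      rw [h1, Pi.smul_apply, h2, smul_eq_mul, Finset.mul_sum]
      exact Finset.sum_congr rfl fun i _ => (mul_assoc _ _ _).symm

lemma condFiberNorm_eq {X : Type*} {m m0 : MeasurableSpace X} {μ : Measure X} {π : X → Y}
    (hmπ : m = MeasurableSpace.comap π inferInstance) (h : Lp ℝ 2 μ) (x : X) :
    condFiberNorm μ π h x = √(cip m μ h h x) := by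
  subst hmπ
  simp only [condFiberNorm, cip, pow_two]

end ModuleSpan

section Factor

variable {G : Type*} [Group G] [MeasurableSpace G]
  {X : Type*} {m m0 : MeasurableSpace X} [MulAction G X] {μ : Measure X} [IsSystem G X μ]
  {Y : Type*} [MeasurableSpace Y] [MulAction G Y] {ν : Measure Y} [IsSystem G Y ν]
  {π : X → Y}

omit [IsSystem G X μ] in
lemma IsFactorMap.measurable_smul_comap (ν : Measure Y) [IsSystem G Y ν]
    (hπ : IsFactorMap G μ ν π) (g : G) :
    Measurable[MeasurableSpace.comap π inferInstance, MeasurableSpace.comap π inferInstance]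
      fun x : X => g • x := by
  rintro _ ⟨E, hE, rfl⟩
  refine ⟨(fun y => g • y) ⁻¹' E, (IsSystem.measurePreserving (μ := ν) g).measurable hE, ?_⟩
  ext x
  simp [hπ.equivariant]

/-- The elements of invariant closed modules with fibres of bounded dimension are
eigenfunctions: the module generated by their orbits is a closed submodule of such a module. -/
lemma InFiniteModule.isEigenfunction (hmπ : m = MeasurableSpace.comap π inferInstance)
    (hπ : IsFactorMap G μ ν π) {f : Lp ℝ 2 μ}
    (hf : InFiniteModule G m μ f) :
    IsEigenfunction G μ ν π f := by
  subst hmπ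
  have : IsProbabilityMeasure μ := IsSystem.isProbabilityMeasure G
  have : IsProbabilityMeasure ν := IsSystem.isProbabilityMeasure G
  have : MeasurableSpace.CountablyGenerated X := IsSystem.countablyGenerated G μ
  have : Fact ((2 : ℝ≥0∞) ≠ ∞) := ⟨by norm_num⟩
  have hm := hπ.measurePreserving.measurable.comap_le
  obtain ⟨M, hM, hMG, ⟨k, hk⟩, hfM⟩ := hf
  set O : Set (Lp ℝ 2 μ) := Set.range fun g : G => koopman μ g f
  have hN := isRelModule_closure_moduleSpan (μ := μ) (ν := ν) hπ.measurePreserving.measurable O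
  have hNM : (moduleSpan μ ν π O).topologicalClosure ≤ M := by
    refine Submodule.topologicalClosure_minimal _
      (moduleSpan_le hπ.measurePreserving hM ?_) hM.isClosed
    rintro _ ⟨g, rfl⟩
    exact hMG g f hfM
  obtain ⟨ψ, hψN, hψ⟩ := hN.exists_generators hm hk hNM
  refine ⟨k, ψ, ?_⟩
  have hC := isRelModule_closure_moduleSpan (μ := μ) (ν := ν) hπ.measurePreserving.measurable
    (Set.range ψ)
  have hCN : (moduleSpan μ ν π (Set.range ψ)).topologicalClosure ≤
      (moduleSpan μ ν π O).topologicalClosure := by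
    refine Submodule.topologicalClosure_minimal _
      (moduleSpan_le hπ.measurePreserving hN ?_) hN.isClosed
    rintro _ ⟨i, rfl⟩
    exact hψN i
  rw [combinations_eq_moduleSpan hπ.measurePreserving, ← Submodule.topologicalClosure_coe,
    ← Submodule.topologicalClosure_coe]
  refine congrArg _ (le_antisymm hCN fun h hh => ?_)
  set C := (moduleSpan μ ν π (Set.range ψ)).topologicalClosure
  have h1 : h - C.starProjection h ∈ Cᗮ := Submodule.sub_starProjection_mem_orthogonal h
  have h2 : h - C.starProjection h = 0 := by
    refine hψ _ (Submodule.sub_mem _ hh (hCN (Submodule.starProjection_apply_mem C h)))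
      fun i => ?_
    rw [cip_comm]
    exact hC.cip_eq_zero hm
      (Submodule.le_topologicalClosure _ (subset_moduleSpan _ ⟨i, rfl⟩)) h1
  rw [sub_eq_zero.1 h2]
  exact Submodule.starProjection_apply_mem C h

end Factor

/-! ### Almost periodic functions are limits of sums of eigenfunctions -/

section AlmostPeriodic

variable {G : Type*} [Group G] [TopologicalSpace G] [IsTopologicalGroup G] [T2Space G]
  [LocallyCompactSpace G] [SecondCountableTopology G] [MeasurableSpace G] [BorelSpace G]
  {X : Type*} {m m0 : MeasurableSpace X} [MulAction G X] {μ : Measure X} [IsSystem G X μ]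
  {Y : Type*} [MeasurableSpace Y] [MulAction G Y] {ν : Measure Y} [IsSystem G Y ν]
  {π : X → Y}

/-- An almost periodic function is orthogonal to every `h` which has bounded fibre norms and is
orthogonal to the invariant modules with fibres of bounded dimension. Indeed, the coefficients
`E(h T^g ξ | Y)`, for `ξ` in a finite net of the orbit, are simultaneously small for some `g`. -/
lemma IsAlmostPeriodic.inner_eq_zero
    (hmπ : m = MeasurableSpace.comap π inferInstance) {L : (G →ᵇ ℝ) →ₗ[ℝ] ℝ} (hL : IsInvariantMean L)
    {Γ : Subgroup G} (hΓ : Dense (Γ : Set G)) (hπ : IsFactorMap G μ ν π) {f h : Lp ℝ 2 μ} {C : ℝ}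
    (hf : IsAlmostPeriodic Γ μ ν π (condFiberNorm μ π) f)
    (hC : ∀ᵐ x ∂μ, cip m μ h h x ≤ C)
    (hort : ∀ e : Lp ℝ 2 μ,
      InFiniteModule G m μ e → inner ℝ e h = 0) :
    inner ℝ h f = 0 := by
  have : IsProbabilityMeasure μ := IsSystem.isProbabilityMeasure G
  have : IsProbabilityMeasure ν := IsSystem.isProbabilityMeasure G
  have hm : m ≤ m0 := hmπ ▸ hπ.measurePreserving.measurable.comap_le
  have hinv : ∀ g : G, Measurable[m, m] fun x : X => g • x :=
    hmπ ▸ hπ.measurable_smul_comap ν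
  set D : ℝ := √C * (2 + ‖f‖ ^ 2) + 2
  have key : ∀ s : ℝ, 0 < s → s ≤ 1 → |inner ℝ h f| ≤ s * D := by
    intro s hs hs1
    obtain ⟨Ξ, -, E, hE, hνE, hAP⟩ := hf (s ^ 2) (by positivity)
    set η : ℝ := s / (Ξ.card + 1)
    have hη : 0 < η := by positivity
    set Φ : G →ᵇ ℝ := ∑ ξ ∈ Ξ, orbitForm G (coefL hm hC) ξ ξ
    have hΦ : L Φ = 0 := by
      rw [map_sum]
      exact Finset.sum_eq_zero fun ξ _ => mean_orbitForm_eq_zero hL hm hinv hC hort ξ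
    obtain ⟨g, hgΓ, hg⟩ : ∃ g ∈ Γ, Φ g < s * η := by
      have hne : {g | Φ g < s * η}.Nonempty := by
        by_contra hne
        have h1 : ∀ g, s * η ≤ Φ g := fun g => not_lt.1 fun h => hne ⟨g, h⟩
        have h2 := hL.le_of_forall_ge h1
        rw [hΦ] at h2
        exact absurd h2 (not_le.2 (by positivity))
      obtain ⟨g, h1, h2⟩ := hΓ.exists_mem_open
        (isOpen_lt (map_continuous Φ) continuous_const) hne
      exact ⟨g, h1, h2⟩
    have hmp := IsSystem.measurePreserving (μ := μ) g
    set F : Set X := (fun x => g • x) ⁻¹' (π ⁻¹' E)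
    have hFm : MeasurableSet F := hmp.measurable (hπ.measurePreserving.measurable hE)
    have hμF : μ.real Fᶜ ≤ s ^ 2 := by
      have h1 : μ.real F = ν.real E := by
        rw [hmp.measureReal_preimage
          (hπ.measurePreserving.measurable hE).nullMeasurableSet,
          hπ.measurePreserving.measureReal_preimage hE.nullMeasurableSet]
      rw [probReal_compl_eq_one_sub hFm, h1]
      linarith
    set c : Lp ℝ 2 μ → X → ℝ := fun ξ => cip m μ h (koopman μ g ξ)
    have hci : ∀ ξ, Integrable (fun x => c ξ x * c ξ x) μ := fun ξ =>
      (memLp_cip hm hC _).integrable_mul (memLp_cip hm hC _)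
    have hsum : ∑ ξ ∈ Ξ, ∫ x, c ξ x * c ξ x ∂μ < s * η := by
      rw [BoundedContinuousFunction.coe_sum, Finset.sum_apply] at hg
      simpa only [orbitForm_apply, inner_coefL] using hg
    -- On `F` the net approximates `f`; on the complement the inequality `√q ≤ s q + 1 / s` is used.
    have hpt : ∀ᵐ x ∂μ, |cip m μ h f x| ≤ (√C * s ^ 2 + Ξ.card * η) +
        (∑ ξ ∈ Ξ, c ξ x * c ξ x) / η + √C * s * cip m μ f f x +
        √C / s * Fᶜ.indicator 1 x := by
      have h1 : ∀ᵐ x ∂μ, x ∈ F → ∃ ξ ∈ Ξ,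
          cip m μ (f - koopman μ g ξ) (f - koopman μ g ξ) x ≤ (s ^ 2) ^ 2 := by
        have h2 : ∀ᵐ x ∂μ, ∀ ξ ∈ Ξ,
            cip m μ (f - koopman μ g ξ) (f - koopman μ g ξ) x =
            cip m μ (koopman μ g⁻¹ f - ξ) (koopman μ g⁻¹ f - ξ) (g • x) := by
          refine (ae_ball_iff Ξ.countable_toSet).2 fun ξ _ => ?_
          have h3 : f - koopman μ g ξ = koopman μ g (koopman μ g⁻¹ f - ξ) := by
            rw [← koopmanLI_apply g (koopman μ g⁻¹ f - ξ), map_sub, koopmanLI_apply,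
              koopmanLI_apply, koopman_koopman_inv]
          rw [h3]
          exact cip_koopman hm hinv g _ _
        filter_upwards [h2, hmp.quasiMeasurePreserving.ae (hAP g⁻¹ (Γ.inv_mem hgΓ))]
          with x h3 h4 hx
        obtain ⟨ξ, hξ, h5⟩ := h4 hx
        refine ⟨ξ, hξ, ?_⟩
        rw [condFiberNorm_eq hmπ] at h5
        rw [h3 ξ hξ]
        exact (Real.sqrt_le_left (by positivity)).1 h5
      have h2 : ∀ᵐ x ∂μ, ∀ ξ ∈ Ξ,
          cip m μ h (f - koopman μ g ξ) x = cip m μ h f x - c ξ x ∧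
          cip m μ h (f - koopman μ g ξ) x ^ 2 ≤
            C * cip m μ (f - koopman μ g ξ) (f - koopman μ g ξ) x := by
        refine (ae_ball_iff Ξ.countable_toSet).2 fun ξ _ => ?_
        filter_upwards [cip_sub_left (m := m) f (koopman μ g ξ) h,
          cip_sq_le_of_bound hC (f - koopman μ g ξ)] with x h3 h4
        refine ⟨?_, h4⟩
        rw [cip_comm, h3, Pi.sub_apply, cip_comm, cip_comm (koopman μ g ξ)]
      filter_upwards [h1, h2, cip_sq_le_of_bound hC f, cip_self_nonneg (m := m) f, hC,
        cip_self_nonneg (m := m) h] with x h1 h2 h3 h4 h5 h6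
      have hC0 : 0 ≤ C := h6.trans h5
      have hnn : 0 ≤ ∑ ξ ∈ Ξ, c ξ x * c ξ x := Finset.sum_nonneg fun _ _ => mul_self_nonneg _
      by_cases hx : x ∈ F
      · obtain ⟨ξ, hξ, h7⟩ := h1 hx
        obtain ⟨h8, h9⟩ := h2 ξ hξ
        have h10 : |cip m μ h f x - c ξ x| ≤ √C * s ^ 2 := by
          refine abs_le_of_sq_le_sq ?_ (by positivity)
          rw [← h8, mul_pow, Real.sq_sqrt hC0]
          exact h9.trans (by gcongr)
        have h11 : |c ξ x| ≤ Ξ.card * η + (∑ ξ ∈ Ξ, c ξ x * c ξ x) / η := by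
          have h12 : |c ξ x| ≤ η + c ξ x * c ξ x / η := by
            rw [← abs_mul_abs_self (c ξ x), ← sub_le_iff_le_add', le_div_iff₀ hη]
            nlinarith [sq_nonneg (|c ξ x| - η), abs_nonneg (c ξ x)]
          refine h12.trans (add_le_add ?_ ?_)
          · refine le_mul_of_one_le_left hη.le ?_
            exact_mod_cast Finset.card_pos.2 ⟨ξ, hξ⟩
          · gcongr
            exact Finset.single_le_sum (f := fun ξ => c ξ x * c ξ x)
              (fun _ _ => mul_self_nonneg _) hξ
        have h12 : |cip m μ h f x| ≤ |cip m μ h f x - c ξ x| + |c ξ x| := by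
          have := abs_add_le (cip m μ h f x - c ξ x) (c ξ x)
          rwa [sub_add_cancel] at this
        rw [Set.indicator_of_notMem (by simpa using hx), mul_zero, add_zero]
        have : 0 ≤ √C * s * cip m μ f f x := mul_nonneg (by positivity) h4
        linarith
      · rw [Set.indicator_of_mem (by simpa using hx), Pi.one_apply, mul_one]
        have h7 : |cip m μ h f x| ≤ √C * √(cip m μ f f x) := by
          refine abs_le_of_sq_le_sq ?_ (by positivity)
          rwa [mul_pow, Real.sq_sqrt hC0, Real.sq_sqrt h4]
        have h8 : √(cip m μ f f x) ≤ s * cip m μ f f x + 1 / s := by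
          rw [← sub_le_iff_le_add', le_div_iff₀ hs]
          nlinarith [sq_nonneg (√(cip m μ f f x) * s - 1), Real.sq_sqrt h4]
        have h9 : |cip m μ h f x| ≤ √C * (s * cip m μ f f x + 1 / s) :=
          h7.trans (by gcongr)
        have h10 : √C * (s * cip m μ f f x + 1 / s) = √C * s * cip m μ f f x + √C / s := by ring
        have : 0 ≤ (√C * s ^ 2 + Ξ.card * η) + (∑ ξ ∈ Ξ, c ξ x * c ξ x) / η :=
          add_nonneg (by positivity) (div_nonneg hnn hη.le)
        linarith
    have hi1 : Integrable (fun x => (∑ ξ ∈ Ξ, c ξ x * c ξ x) / η) μ :=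
      (integrable_finsetSum _ fun ξ _ => hci ξ).div_const η
    have hi2 : Integrable (fun x => √C * s * cip m μ f f x) μ := (integrable_cip f f).const_mul _
    have hi3 : Integrable (fun x => √C / s * Fᶜ.indicator (1 : X → ℝ) x) μ :=
      ((integrable_const (1 : ℝ)).indicator hFm.compl).const_mul _
    have hi4 : Integrable (fun x => (√C * s ^ 2 + Ξ.card * η) +
        (∑ ξ ∈ Ξ, c ξ x * c ξ x) / η) μ := (integrable_const _).add hi1
    have hi5 : Integrable (fun x => (√C * s ^ 2 + Ξ.card * η) +
        (∑ ξ ∈ Ξ, c ξ x * c ξ x) / η + √C * s * cip m μ f f x) μ := hi4.add hi2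
    calc |inner ℝ h f| ≤ ∫ x, |cip m μ h f x| ∂μ := by
          rw [← integral_cip hm]
          exact abs_integral_le_integral_abs
      _ ≤ ∫ x, ((√C * s ^ 2 + Ξ.card * η) + (∑ ξ ∈ Ξ, c ξ x * c ξ x) / η +
            √C * s * cip m μ f f x + √C / s * Fᶜ.indicator 1 x) ∂μ :=
          integral_mono_ae (integrable_cip h f).abs
            (hi5.add hi3) hpt
      _ = (√C * s ^ 2 + Ξ.card * η) + (∑ ξ ∈ Ξ, ∫ x, c ξ x * c ξ x ∂μ) / η +
            √C * s * ‖f‖ ^ 2 + √C / s * μ.real Fᶜ := by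
          rw [integral_add hi5 hi3, integral_add hi4 hi2,
            integral_add (integrable_const _) hi1, integral_const, integral_div,
            integral_finsetSum _ fun ξ _ => hci ξ, integral_const_mul, integral_const_mul,
            integral_cip_self hm, integral_indicator_one hFm.compl, probReal_univ, one_smul]
      _ ≤ (√C * s + s) + s + √C * s * ‖f‖ ^ 2 + √C * s := by
          refine add_le_add (add_le_add (add_le_add (add_le_add ?_ ?_) ?_) le_rfl) ?_
          · gcongr
            nlinarith
          · rw [← mul_div_assoc, div_le_iff₀ (by positivity)]
            nlinarith
          · rw [div_le_iff₀ hη]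
            exact hsum.le
          · rw [div_mul_eq_mul_div, div_le_iff₀ hs, mul_assoc, ← pow_two]
            gcongr
      _ = s * D := by ring
  have hD : 0 < D := by positivity
  refine abs_eq_zero.1 (le_antisymm (le_of_forall_pos_le_add fun ε hε => ?_) (abs_nonneg _))
  refine (key (min 1 (ε / D)) (by positivity) (min_le_left _ _)).trans ?_
  rw [zero_add]
  calc min 1 (ε / D) * D ≤ ε / D * D := by gcongr; exact min_le_right _ _
    _ = ε := div_mul_cancel₀ _ hD.ne'

/-- Almost periodic functions are limits of sums of eigenfunctions. -/
lemma IsAlmostPeriodic.mem_eigenspan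
    (hmπ : m = MeasurableSpace.comap π inferInstance) (hG : IsAmenable G) {Γ : Subgroup G}
    (hΓ : Dense (Γ : Set G)) (hπ : IsFactorMap G μ ν π) {f : Lp ℝ 2 μ}
    (hf : IsAlmostPeriodic Γ μ ν π (condFiberNorm μ π) f) : f ∈ eigenspan G μ ν π := by
  have : IsProbabilityMeasure μ := IsSystem.isProbabilityMeasure G
  obtain ⟨L, hL0, hL1, hLi⟩ := hG
  have hL : IsInvariantMean L := ⟨hL0, hL1, hLi⟩
  have hm : m ≤ m0 := hmπ ▸ hπ.measurePreserving.measurable.comap_le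
  refine mem_of_forall_orthogonal (Submodule.isClosed_topologicalClosure _) fun h hh => ?_
  have hort : ∀ M : Submodule ℝ (Lp ℝ 2 μ), IsRelModule m M →
      (∀ (g : G), ∀ u ∈ M, koopman μ g u ∈ M) → (∃ k, RelDimLT m M k) → h ∈ Mᗮ :=
    fun M hM hMG hMk => (Submodule.mem_orthogonal _ _).2 fun e he =>
      Submodule.inner_right_of_mem_orthogonal (Submodule.le_topologicalClosure _
        (Submodule.subset_span (InFiniteModule.isEigenfunction hmπ hπ ⟨M, hM, hMG, hMk, he⟩))) hh
  -- Truncation makes the fibre norms of `h` bounded.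
  refine inner_eq_zero_of_truncations hm fun n w hw => ?_
  refine IsAlmostPeriodic.inner_eq_zero hmπ hL hΓ hπ hf (cip_truncation_le n.cast_nonneg hw) ?_
  rintro e ⟨M, hM, hMG, hMk, he⟩
  exact Submodule.inner_right_of_mem_orthogonal he
    ((hM.orthogonal hm).indicator_mem _ (measurableSet_cip_le h n) h (hort M hM hMG hMk) w hw)

end AlmostPeriodic

/-! ### Eigenfunctions are limits of almost periodic functions -/

section FiniteSums

variable {X : Type*} {m m0 : MeasurableSpace X} {μ : Measure X}

lemma cip_sum_smul_left {ι : Type*} [Fintype ι] (r : ι → ℝ) (v : ι → Lp ℝ 2 μ) (w : Lp ℝ 2 μ) :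
    ∀ᵐ x ∂μ, cip m μ (∑ i, r i • v i) w x = ∑ i, r i * cip m μ (v i) w x := by
  classical
  have h : ∀ s : Finset ι, ∀ᵐ x ∂μ, cip m μ (∑ i ∈ s, r i • v i) w x =
      ∑ i ∈ s, r i * cip m μ (v i) w x := by
    intro s
    induction s using Finset.induction_on with
    | empty =>
      filter_upwards [(relOrthogonal m (fun _ : Unit => w)).zero_mem ()] with x hx
      simpa only [Finset.sum_empty, Pi.zero_apply] using hx
    | insert i s hi ih =>
      rw [Finset.sum_insert hi]
      filter_upwards [ih, cip_add_left (m := m) (r i • v i) (∑ i ∈ s, r i • v i) w,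
        cip_smul_left (m := m) (r i) (v i) w] with x h1 h2 h3
      rw [h2, Pi.add_apply, h1, h3, Pi.smul_apply, smul_eq_mul, Finset.sum_insert hi]
  exact h Finset.univ

lemma cip_sum_smul_self_le {ι : Type*} [Fintype ι] (r : ι → ℝ) (v : ι → Lp ℝ 2 μ) :
    ∀ᵐ x ∂μ, cip m μ (∑ i, r i • v i) (∑ i, r i • v i) x ≤
      (Fintype.card ι + 1) * ∑ i, r i ^ 2 * cip m μ (v i) (v i) x := by
  set z := ∑ i, r i • v i
  filter_upwards [cip_sum_smul_left (m := m) r v z, ae_all_iff.2 fun i => cip_sq_le (m := m) (v i) z,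
    ae_all_iff.2 fun i => cip_self_nonneg (m := m) (v i), cip_self_nonneg (m := m) z]
    with x h1 h2 h3 h4
  set Z := cip m μ z z x
  set n : ℝ := Fintype.card ι + 1
  have hn : 0 < n := by positivity
  have h5 : ∀ i, r i * cip m μ (v i) z x ≤
      n * (r i ^ 2 * cip m μ (v i) (v i) x) / 2 + Z / n / 2 := by
    intro i
    have h6 : (r i * cip m μ (v i) z x) ^ 2 ≤
        (n * (r i ^ 2 * cip m μ (v i) (v i) x)) * (Z / n) := by
      have : (n * (r i ^ 2 * cip m μ (v i) (v i) x)) * (Z / n) =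
          r i ^ 2 * (cip m μ (v i) (v i) x * Z) := by
        field_simp
      rw [this, mul_pow]
      exact mul_le_mul_of_nonneg_left (h2 i) (sq_nonneg _)
    have h7 : 0 ≤ n * (r i ^ 2 * cip m μ (v i) (v i) x) :=
      mul_nonneg hn.le (mul_nonneg (sq_nonneg _) (h3 i))
    have h8 : 0 ≤ Z / n := div_nonneg h4 hn.le
    rw [← add_div]
    refine (abs_le_of_sq_le_sq' ?_ (by positivity)).2
    nlinarith [sq_nonneg (n * (r i ^ 2 * cip m μ (v i) (v i) x) - Z / n)]
  have h6 : Z ≤ ∑ i, (n * (r i ^ 2 * cip m μ (v i) (v i) x) / 2 + Z / n / 2) :=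
    h1.le.trans (Finset.sum_le_sum fun i _ => h5 i)
  rw [Finset.sum_add_distrib, ← Finset.sum_div, ← Finset.mul_sum, Finset.sum_const,
    Finset.card_univ, nsmul_eq_mul] at h6
  have h7 : (Fintype.card ι : ℝ) * (Z / n / 2) ≤ Z / 2 := by
    have : (Fintype.card ι : ℝ) * (Z / n / 2) = (Fintype.card ι / n) * (Z / 2) := by ring
    rw [this]
    refine mul_le_of_le_one_left (by linarith) ?_
    rw [div_le_one hn]
    simp [n]
  linarith

/-- Essentially bounded functions are dense in `L²`. -/
lemma exists_memLp_top_norm_sub_lt (v : Lp ℝ 2 μ) {τ : ℝ} (hτ : 0 < τ) :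
    ∃ v' : Lp ℝ 2 μ, MemLp v' ∞ μ ∧ ‖v - v'‖ < τ := by
  obtain ⟨g, hg⟩ := (Lp.simpleFunc.denseRange (E := ℝ) (p := 2) (μ := μ)
    (by norm_num)).exists_dist_lt v hτ
  rw [dist_eq_norm] at hg
  exact ⟨g, ((SimpleFunc.memLp_top (Lp.simpleFunc.toSimpleFunc g) μ).ae_eq
    (Lp.simpleFunc.toSimpleFunc_eq_toFun g)), hg⟩

lemma memLp_top_sum_smul {ι : Type*} (s : Finset ι) (r : ι → ℝ) {v : ι → Lp ℝ 2 μ}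
    (hv : ∀ i, MemLp (v i) ∞ μ) :
    MemLp (∑ i ∈ s, r i • v i : Lp ℝ 2 μ) ∞ μ :=
  Finset.sum_induction _ (fun w : Lp ℝ 2 μ => MemLp w ∞ μ)
    (fun u w hu hw => (hu.add hw).ae_eq (Lp.coeFn_add u w).symm)
    (MemLp.zero.ae_eq (Lp.coeFn_zero ℝ 2 μ).symm)
    fun i _ => ((hv i).const_smul (r i)).ae_eq (Lp.coeFn_smul (r i) (v i)).symm

/-- The fibre distance from a relatively finite sum `w = ∑ cᵢ ψᵢ` to a sum `∑ rᵢ ψ'ᵢ` with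
constant coefficients. -/
lemma IsRelOrthonormal.cip_sub_sum_le [IsProbabilityMeasure μ] (hm : m ≤ m0) {ι : Type*}
    [Fintype ι] {ψ : ι → Lp ℝ 2 μ} (h : IsRelOrthonormal m ψ) {w : Lp ℝ 2 μ}
    (hw : w ∈ (relOrthogonal m ψ)ᗮ) (r : ι → ℝ) (ψ' : ι → Lp ℝ 2 μ) :
    ∀ᵐ x ∂μ, cip m μ (w - ∑ i, r i • ψ' i) (w - ∑ i, r i • ψ' i) x ≤
      2 * ∑ i, (cip m μ w (ψ i) x - r i) ^ 2 + 2 * ((Fintype.card ι + 1) *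
        ∑ i, r i ^ 2 * cip m μ (ψ i - ψ' i) (ψ i - ψ' i) x) := by
  classical
  set z := ∑ i, r i • ψ i
  set k := ∑ i, r i • (ψ i - ψ' i)
  have hzk : w - ∑ i, r i • ψ' i = (w - z) + k := by
    simp only [z, k, smul_sub, Finset.sum_sub_distrib]
    abel
  obtain ⟨w', hw', hwc, -⟩ := h.exists_proj hm w
  have hww : w' = w := Lp.ext (hw'.trans (h.ae_eq_sum hm hw).symm)
  rw [hww] at hwc
  have h0 : ∀ᵐ x ∂μ, ∀ i j, i ≠ j → cip m μ (ψ i) (ψ j) x = 0 := by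
    refine ae_all_iff.2 fun i => ae_all_iff.2 fun j => ?_
    by_cases hij : i = j
    · exact ae_of_all _ fun x hx => absurd hij hx
    · filter_upwards [h.orthogonal i j hij] with x hx _ using hx
  rw [hzk]
  filter_upwards [cip_add_self_le (m := m) (w - z) k,
    cip_sum_smul_self_le (m := m) r fun i => ψ i - ψ' i, hwc (w - z),
    cip_sum_smul_left (m := m) r ψ (w - z), cip_sub_left (m := m) w z (w - z),
    ae_all_iff.2 fun i => cip_sub_left (m := m) w z (ψ i),
    ae_all_iff.2 fun i => cip_sum_smul_left (m := m) r ψ (ψ i), h0,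
    ae_all_iff.2 fun i => h.cip_mul_self w i, ae_all_iff.2 h.self_le_one]
    with x h1 h2 h3 h4 h5 h6 h7 h8 h9 h10
  refine h1.trans ?_
  gcongr 2 * ?_ + 2 * ?_
  rw [h5, Pi.sub_apply, h3, h4, ← Finset.sum_sub_distrib]
  refine Finset.sum_le_sum fun i _ => ?_
  have h11 : cip m μ (ψ i) (w - z) x =
      (cip m μ w (ψ i) x - r i) * cip m μ (ψ i) (ψ i) x := by
    rw [cip_comm, h6 i, Pi.sub_apply, h7 i, sub_mul, h9 i,
      Finset.sum_eq_single i (fun j _ hj => by rw [h8 j i hj, mul_zero])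
        (fun hi => absurd (Finset.mem_univ i) hi)]
  rw [h11]
  nlinarith [mul_nonneg (sq_nonneg (cip m μ w (ψ i) x - r i)) (sub_nonneg.2 (h10 i))]

end FiniteSums

section EigenAlmostPeriodic

variable {G : Type*} [Group G] [MeasurableSpace G]
  {X : Type*} {m m0 : MeasurableSpace X} [MulAction G X] {μ : Measure X} [IsSystem G X μ]
  {Y : Type*} [MeasurableSpace Y] {ν : Measure Y}
  {π : X → Y}

lemma isAlmostPeriodic_iff (hmπ : m = MeasurableSpace.comap π inferInstance) {Γ : Subgroup G}
    {f : Lp ℝ 2 μ} : IsAlmostPeriodic Γ μ ν π (condFiberNorm μ π) f ↔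
      ∀ ε : ℝ, 0 < ε → ∃ Ξ : Finset (Lp ℝ 2 μ), (∀ ξ ∈ Ξ, MemLp ξ ∞ μ) ∧
        ∃ E : Set Y, MeasurableSet E ∧ 1 - ε < ν.real E ∧
          ∀ γ ∈ Γ, ∀ᵐ x ∂μ, π x ∈ E →
            ∃ ξ ∈ Ξ, cip m μ (koopman μ γ f - ξ) (koopman μ γ f - ξ) x ≤ ε ^ 2 := by
  refine forall₂_congr fun ε hε => ?_
  simp only [condFiberNorm_eq hmπ, Real.sqrt_le_left hε.le]

/-- The almost periodic functions form a linear subspace. -/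
def apSubmodule (Γ : Subgroup G) (μ : Measure X) [IsSystem G X μ]
    (ν : Measure Y) [IsProbabilityMeasure ν] (π : X → Y) : Submodule ℝ (Lp ℝ 2 μ) where
  carrier := {f | IsAlmostPeriodic Γ μ ν π (condFiberNorm μ π) f}
  zero_mem' := by
    refine (isAlmostPeriodic_iff rfl).2 fun ε hε => ⟨{0}, fun ξ hξ => ?_, Set.univ,
      MeasurableSet.univ, by simpa using hε, fun γ _ => ?_⟩
    · rw [Finset.mem_singleton.1 hξ]
      exact MemLp.zero.ae_eq (Lp.coeFn_zero ℝ 2 μ).symm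
    · filter_upwards [(relOrthogonal (MeasurableSpace.comap π inferInstance)
        (fun _ : Unit => (0 : Lp ℝ 2 μ))).zero_mem ()] with x hx _
      refine ⟨0, Finset.mem_singleton_self _, ?_⟩
      rw [← koopmanLI_apply, map_zero, sub_zero, hx]
      exact sq_nonneg ε
  add_mem' := by
    classical
    intro f f' hf hf'
    refine (isAlmostPeriodic_iff rfl).2 fun ε hε => ?_
    obtain ⟨Ξ, hΞ, E, hE, hνE, h⟩ := (isAlmostPeriodic_iff rfl).1 hf (ε / 2) (half_pos hε)
    obtain ⟨Ξ', hΞ', E', hE', hνE', h'⟩ := (isAlmostPeriodic_iff rfl).1 hf' (ε / 2) (half_pos hε)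
    refine ⟨Finset.image₂ (· + ·) Ξ Ξ', fun ξ hξ => ?_, E ∩ E', hE.inter hE', ?_, fun γ hγ => ?_⟩
    · obtain ⟨a, ha, b, hb, rfl⟩ := Finset.mem_image₂.1 hξ
      exact ((hΞ a ha).add (hΞ' b hb)).ae_eq (Lp.coeFn_add a b).symm
    · have h1 := measureReal_union_add_inter (μ := ν) (s := E) hE'
      have h2 : ν.real (E ∪ E') ≤ 1 := measureReal_le_one
      linarith
    · have h3 : ∀ᵐ x ∂μ, ∀ ξ ∈ Ξ, ∀ ξ' ∈ Ξ', cip (MeasurableSpace.comap π inferInstance) μ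
          (koopman μ γ (f + f') - (ξ + ξ')) (koopman μ γ (f + f') - (ξ + ξ')) x ≤
          2 * cip (MeasurableSpace.comap π inferInstance) μ
            (koopman μ γ f - ξ) (koopman μ γ f - ξ) x +
          2 * cip (MeasurableSpace.comap π inferInstance) μ
            (koopman μ γ f' - ξ') (koopman μ γ f' - ξ') x := by
        refine (ae_ball_iff Ξ.countable_toSet).2 fun ξ _ =>
          (ae_ball_iff Ξ'.countable_toSet).2 fun ξ' _ => ?_
        have h4 : koopman μ γ (f + f') - (ξ + ξ') =
            (koopman μ γ f - ξ) + (koopman μ γ f' - ξ') := by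
          rw [← koopmanLI_apply, map_add, koopmanLI_apply, koopmanLI_apply]
          abel
        rw [h4]
        exact cip_add_self_le _ _
      filter_upwards [h γ hγ, h' γ hγ, h3] with x h1 h2 h3 hx
      obtain ⟨ξ, hξ, h4⟩ := h1 hx.1
      obtain ⟨ξ', hξ', h5⟩ := h2 hx.2
      refine ⟨ξ + ξ', Finset.mem_image₂_of_mem hξ hξ', (h3 ξ hξ ξ' hξ').trans ?_⟩
      nlinarith
  smul_mem' := by
    classical
    intro c f hf
    refine (isAlmostPeriodic_iff rfl).2 fun ε hε => ?_
    obtain ⟨Ξ, hΞ, E, hE, hνE, h⟩ := (isAlmostPeriodic_iff rfl).1 hf (ε / (|c| + 1))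
      (by positivity)
    refine ⟨Ξ.image (c • ·), fun ξ hξ => ?_, E, hE, ?_, fun γ hγ => ?_⟩
    · obtain ⟨a, ha, rfl⟩ := Finset.mem_image.1 hξ
      exact ((hΞ a ha).const_smul c).ae_eq (Lp.coeFn_smul c a).symm
    · have : ε / (|c| + 1) ≤ ε := div_le_self hε.le (by linarith [abs_nonneg c])
      linarith
    · have h3 : ∀ᵐ x ∂μ, ∀ ξ ∈ Ξ, cip (MeasurableSpace.comap π inferInstance) μ
          (koopman μ γ (c • f) - c • ξ) (koopman μ γ (c • f) - c • ξ) x =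
          c ^ 2 * cip (MeasurableSpace.comap π inferInstance) μ
            (koopman μ γ f - ξ) (koopman μ γ f - ξ) x := by
        refine (ae_ball_iff Ξ.countable_toSet).2 fun ξ _ => ?_
        rw [← koopmanLI_apply, map_smul, koopmanLI_apply, ← smul_sub]
        exact cip_smul_smul c _
      filter_upwards [h γ hγ, h3] with x h1 h3 hx
      obtain ⟨ξ, hξ, h4⟩ := h1 hx
      refine ⟨c • ξ, Finset.mem_image_of_mem _ hξ, ?_⟩
      rw [h3 ξ hξ]
      calc c ^ 2 * _ ≤ c ^ 2 * (ε / (|c| + 1)) ^ 2 := by gcongr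
        _ = (|c| / (|c| + 1)) ^ 2 * ε ^ 2 := by rw [← sq_abs c]; ring
        _ ≤ 1 * ε ^ 2 := by
          gcongr
          exact pow_le_one₀ (by positivity) (div_le_one_of_le₀ (by linarith) (by positivity))
        _ = ε ^ 2 := one_mul _

/-- If the orbit of `u` has bounded fibre norms and lies in the module generated by a finite
relatively orthonormal family, then `u` is almost periodic: the coefficients range over a compact
set, of which a finite net is taken. -/
lemma isAlmostPeriodic_of_bounded [IsProbabilityMeasure ν]
    (hmπ : m = MeasurableSpace.comap π inferInstance) (hπ : MeasurePreserving π μ ν)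
    {Γ : Subgroup G} {d : ℕ} {ψ : Fin d → Lp ℝ 2 μ} (hψ : IsRelOrthonormal m ψ) {u : Lp ℝ 2 μ}
    {R : ℝ} (hu : ∀ γ ∈ Γ, koopman μ γ u ∈ (relOrthogonal m ψ)ᗮ)
    (hR : ∀ γ ∈ Γ, ∀ᵐ x ∂μ, cip m μ (koopman μ γ u) (koopman μ γ u) x ≤ R) :
    IsAlmostPeriodic Γ μ ν π (condFiberNorm μ π) u := by
  classical
  have : IsProbabilityMeasure μ := IsSystem.isProbabilityMeasure G
  have hm : m ≤ m0 := hmπ ▸ hπ.measurable.comap_le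
  refine (isAlmostPeriodic_iff hmπ).2 fun ε hε => ?_
  set B : ℝ := √R
  set n : ℝ := d + 1
  have hn : 0 < n := by positivity
  set η : ℝ := ε / (2 * n)
  have hη : 0 < η := by positivity
  set δ : ℝ := ε ^ 2 / (4 * n * (B ^ 2 + 1))
  have hδ : 0 < δ := by positivity
  choose ψ' hψ'b hψ' using fun i =>
    exists_memLp_top_norm_sub_lt (ψ i) (Real.sqrt_pos.2 (by positivity : 0 < δ * ε / n))
  set s : X → ℝ := fun x => ∑ i, cip m μ (ψ i - ψ' i) (ψ i - ψ' i) x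
  have hs0 : 0 ≤ᵐ[μ] s := by
    filter_upwards [ae_all_iff.2 fun i => cip_self_nonneg (m := m) (ψ i - ψ' i)] with x hx
    exact Finset.sum_nonneg fun i _ => hx i
  have hsi : ∫ x, s x ∂μ < δ * ε := by
    rw [integral_finsetSum _ fun i _ => integrable_cip _ _]
    calc _ ≤ ∑ _i : Fin d, δ * ε / n := Finset.sum_le_sum fun i _ => by
          rw [integral_cip_self hm]
          exact ((Real.lt_sqrt (norm_nonneg _)).1 (hψ' i)).le
      _ = (d / n) * (δ * ε) := by
          rw [Finset.sum_const, Finset.card_univ, Fintype.card_fin, nsmul_eq_mul]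
          ring
      _ < 1 * (δ * ε) := by
          gcongr
          rw [div_lt_one hn]
          simp [n]
      _ = δ * ε := one_mul _
  have hsm : Measurable[m] s :=
    Finset.measurable_fun_sum _ fun i _ => (stronglyMeasurable_cip _ _).measurable
  have hSm : MeasurableSet[m] {x | s x < δ} := measurableSet_lt hsm measurable_const
  obtain ⟨E, hE, hES⟩ : ∃ E : Set Y, MeasurableSet E ∧ π ⁻¹' E = {x | s x < δ} := by
    subst hmπ
    exact hSm
  have hνE : 1 - ε < ν.real E := by
    have h1 := mul_meas_ge_le_integral_of_nonneg hs0
      (integrable_finsetSum _ fun i _ => integrable_cip (m := m) _ _) δ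
    have h2 : μ.real {x | δ ≤ s x} < ε := lt_of_mul_lt_mul_left (h1.trans_lt hsi) hδ.le
    have h3 : {x | δ ≤ s x} = {x | s x < δ}ᶜ := by
      ext x
      simp
    rw [h3, probReal_compl_eq_one_sub (hm _ hSm), ← hES,
      hπ.measureReal_preimage hE.nullMeasurableSet] at h2
    linarith
  obtain ⟨t, htB, htf, htc⟩ := (isCompact_closedBall (0 : Fin d → ℝ) B).finite_cover_balls hη
  refine ⟨htf.toFinset.image fun r => ∑ i, r i • ψ' i, fun ξ hξ => ?_, E, hE, hνE,
    fun γ hγ => ?_⟩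
  · obtain ⟨r, -, rfl⟩ := Finset.mem_image.1 hξ
    exact memLp_top_sum_smul _ _ hψ'b
  set w := koopman μ γ u
  filter_upwards [hR γ hγ, ae_all_iff.2 fun i => cip_sq_le (m := m) w (ψ i),
    ae_all_iff.2 hψ.self_le_one, cip_self_nonneg (m := m) w,
    ae_all_iff.2 fun i => cip_self_nonneg (m := m) (ψ i - ψ' i),
    (ae_ball_iff htf.countable).2 fun r _ => hψ.cip_sub_sum_le hm (hu γ hγ) r ψ']
    with x h1 h2 h3 h4 h5 h6 hx
  set c : Fin d → ℝ := fun i => cip m μ w (ψ i) x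
  have hc : c ∈ Metric.closedBall (0 : Fin d → ℝ) B := by
    rw [mem_closedBall_zero_iff, pi_norm_le_iff_of_nonneg (Real.sqrt_nonneg _)]
    intro i
    exact Real.abs_le_sqrt ((h2 i).trans ((mul_le_of_le_one_right h4 (h3 i)).trans h1))
  obtain ⟨r, hr, hcr⟩ := Set.mem_iUnion₂.1 (htc hc)
  refine ⟨_, Finset.mem_image_of_mem _ (htf.mem_toFinset.2 hr), (h6 r hr).trans ?_⟩
  have h7 : ∑ i, (c i - r i) ^ 2 ≤ n * η ^ 2 := by
    calc _ ≤ ∑ _i : Fin d, η ^ 2 := Finset.sum_le_sum fun i _ => by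
          rw [← sq_abs]
          gcongr
          rw [← Real.dist_eq]
          exact (dist_le_pi_dist c r i).trans (Metric.mem_ball.1 hcr).le
      _ = d * η ^ 2 := by simp
      _ ≤ n * η ^ 2 := by
          gcongr
          simp [n]
  have h8 : ∑ i, r i ^ 2 * cip m μ (ψ i - ψ' i) (ψ i - ψ' i) x ≤ (B ^ 2 + 1) * δ := by
    have hx' : s x < δ := by
      have : x ∈ π ⁻¹' E := hx
      rwa [hES] at this
    calc _ ≤ ∑ i, (B ^ 2 + 1) * cip m μ (ψ i - ψ' i) (ψ i - ψ' i) x :=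
          Finset.sum_le_sum fun i _ => by
            refine mul_le_mul_of_nonneg_right ?_ (h5 i)
            have h9 := (pi_norm_le_iff_of_nonneg (Real.sqrt_nonneg _)).1
              (mem_closedBall_zero_iff.1 (htB hr)) i
            have h10 : r i ^ 2 ≤ B ^ 2 := sq_le_sq' (abs_le.1 h9).1 (abs_le.1 h9).2
            linarith
      _ = (B ^ 2 + 1) * s x := (Finset.mul_sum _ _ _).symm
      _ ≤ _ := by gcongr
  calc _ ≤ 2 * (n * η ^ 2) + 2 * (n * ((B ^ 2 + 1) * δ)) := by
        rw [Fintype.card_fin]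
        gcongr
    _ = ε ^ 2 / (2 * n) + ε ^ 2 / 2 := by
        simp only [η, δ]
        field_simp
        ring
    _ ≤ ε ^ 2 / 2 + ε ^ 2 / 2 := by
        gcongr
        simp only [n]
        linarith [(Nat.cast_nonneg d : (0 : ℝ) ≤ d)]
    _ = ε ^ 2 := add_halves _

/-- Eigenfunctions are limits of almost periodic functions, namely of their truncations to the sets
where their fibre norms are bounded. -/
lemma IsEigenfunction.mem_closure [MulAction G Y] [IsSystem G Y ν] [IsProbabilityMeasure ν]
    (hmπ : m = MeasurableSpace.comap π inferInstance) (hπ : IsFactorMap G μ ν π) (Γ : Subgroup G)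
    {f : Lp ℝ 2 μ} (hf : IsEigenfunction G μ ν π f) :
    f ∈ (apSubmodule Γ μ ν π).topologicalClosure := by
  have : IsProbabilityMeasure μ := IsSystem.isProbabilityMeasure G
  have hm : m ≤ m0 := hmπ ▸ hπ.measurePreserving.measurable.comap_le
  have hinv : ∀ g : G, Measurable[m, m] fun x : X => g • x :=
    hmπ ▸ hπ.measurable_smul_comap ν
  obtain ⟨d, φ, hφ⟩ := hf
  rw [combinations_eq_moduleSpan hπ.measurePreserving, ← Submodule.topologicalClosure_coe,
    ← Submodule.topologicalClosure_coe] at hφ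
  set N := (moduleSpan μ ν π (Set.range fun g : G => koopman μ g f)).topologicalClosure
  have hN : IsRelModule m N :=
    hmπ ▸ isRelModule_closure_moduleSpan hπ.measurePreserving.measurable _
  obtain ⟨ψ, hψ, hψφ⟩ := exists_isRelOrthonormal hm d φ
  have hNψ : N ≤ (relOrthogonal m ψ)ᗮ := by
    have hK := (isRelModule_relOrthogonal hm ψ).orthogonal hm
    rw [← SetLike.coe_injective hφ]
    refine Submodule.topologicalClosure_minimal _ (moduleSpan_le hπ.measurePreserving
      (hmπ ▸ hK) ?_) hK.isClosed
    rintro _ ⟨i, rfl⟩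
    refine (Submodule.mem_orthogonal _ _).2 fun v hv => ?_
    rw [← integral_cip hm]
    exact integral_eq_zero_of_ae (hψφ hv i)
  refine mem_of_forall_orthogonal (Submodule.isClosed_topologicalClosure _) fun v hv => ?_
  rw [real_inner_comm]
  refine inner_eq_zero_of_truncations hm fun k w hw => ?_
  refine Submodule.inner_right_of_mem_orthogonal (Submodule.le_topologicalClosure _ ?_) hv
  have hS : ∀ γ : G, MeasurableSet[m] ((fun x => γ • x) ⁻¹' {x | cip m μ f f x ≤ k}) := fun γ =>
    hinv γ (measurableSet_cip_le f k)
  refine isAlmostPeriodic_of_bounded hmπ hπ.measurePreserving hψ (R := k) (fun γ _ => hNψ ?_)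
    fun γ _ => ?_
  · exact hN.indicator_mem _ (hS γ) (koopman μ γ f) (Submodule.le_topologicalClosure _
      (subset_moduleSpan _ ⟨γ, rfl⟩)) _ (koopman_indicator γ hw)
  · filter_upwards [cip_koopman hm hinv γ w w, (IsSystem.measurePreserving
      (μ := μ) γ).quasiMeasurePreserving.ae (cip_truncation_le k.cast_nonneg hw)] with x h1 h2
    rwa [h1]

end EigenAlmostPeriodic

/-! ### Fibre norms through a disintegration -/

section Disintegration

variable {G : Type*} [Group G] {X : Type*} {m m0 : MeasurableSpace X} [MulAction G X]
  {μ : Measure X} {Y : Type*} [MeasurableSpace Y] [MulAction G Y] {ν : Measure Y} {π : X → Y}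
  {μy : Y → Measure X}

/-- The conditional expectation of `h²` is given by integration against a disintegration. As `h²`
need not be square integrable, it is approximated by its truncations `min (h²) n`. -/
lemma IsDisintegration.ae_eq_condFiberNorm [IsProbabilityMeasure μ]
    (hmπ : m = MeasurableSpace.comap π inferInstance) (hπ : MeasurePreserving π μ ν)
    (hd : IsDisintegration G μ ν π μy) (h : Lp ℝ 2 μ) :
    fiberNorm μ π μy h =ᵐ[μ] condFiberNorm μ π h := by
  have hm : m ≤ m0 := hmπ ▸ hπ.measurable.comap_le
  have hhm : Measurable h := (Lp.stronglyMeasurable h).measurable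
  set f : ℕ → X → ℝ := fun n x => min (h x * h x) n
  have hf0 : ∀ n x, 0 ≤ f n x := fun n x => le_min (mul_self_nonneg _) n.cast_nonneg
  have hfh : ∀ n x, f n x ≤ h x * h x := fun n x => min_le_left _ _
  have hfm : ∀ n, Measurable (f n) := fun n => (hhm.mul hhm).min measurable_const
  have hfL : ∀ n, MemLp (f n) 2 μ := fun n =>
    MemLp.of_bound (hfm n).aestronglyMeasurable n (ae_of_all _ fun x => by
      rw [Real.norm_of_nonneg (hf0 n x)]
      exact min_le_right _ _)
  have hfi : ∀ n, Integrable (f n) μ := fun n => (hfL n).integrable one_le_two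
  have hfmono : ∀ x, Monotone fun n => f n x := fun x i j hij =>
    min_le_min_left _ (by exact_mod_cast hij)
  have hft : ∀ x, Tendsto (fun n => f n x) atTop (𝓝 (h x * h x)) := fun x => by
    obtain ⟨N, hN⟩ := exists_nat_ge (h x * h x)
    refine tendsto_const_nhds.congr' ?_
    filter_upwards [eventually_ge_atTop N] with n hn
    exact (min_eq_left (hN.trans (by exact_mod_cast hn))).symm
  set e : ℕ → X → ℝ := fun n => μ[f n | m]
  have he : ∀ n, ∀ᵐ x ∂μ, e n x = ∫ x', f n x' ∂(μy (π x)) := fun n => by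
    subst hmπ
    exact hd.condExp_eq (f n) (hfm n) (hfL n)
  have hele : ∀ n, ∀ᵐ x ∂μ, e n x ≤ cip m μ h h x := fun n =>
    condExp_mono (hfi n) (integrable_coe_mul h h) (ae_of_all _ (hfh n))
  have he0 : ∀ n, ∀ᵐ x ∂μ, 0 ≤ e n x := fun n => condExp_nonneg (ae_of_all _ (hf0 n))
  have hint : ∀ᵐ x ∂μ, ∀ n, Integrable (f n) (μy (π x)) := ae_all_iff.2 fun n =>
    hπ.quasiMeasurePreserving.ae (hd.integrable (f n) (hfm n) (hfL n))
  set k : X → ℝ := fun x => ∫ x', h x' * h x' ∂(μy (π x))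
  have hek : ∀ᵐ x ∂μ, Tendsto (fun n => e n x) atTop (𝓝 (k x)) := by
    filter_upwards [hint, ae_all_iff.2 he, ae_all_iff.2 hele] with x h1 h2 h3
    simp only [h2]
    refine integral_tendsto_of_tendsto_of_monotone h1 ⟨(hhm.mul hhm).aestronglyMeasurable, ?_⟩
      (ae_of_all _ hfmono) (ae_of_all _ hft)
    rw [hasFiniteIntegral_iff_ofReal (ae_of_all _ fun x => mul_self_nonneg _)]
    refine lt_of_le_of_lt ?_ (ENNReal.ofReal_lt_top (r := cip m μ h h x))
    refine le_of_tendsto (lintegral_tendsto_of_tendsto_of_monotone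
      (fun n => (hfm n).ennreal_ofReal.aemeasurable)
      (ae_of_all _ fun x' i j hij => ENNReal.ofReal_le_ofReal (hfmono x' hij))
      (ae_of_all _ fun x' => ENNReal.tendsto_ofReal (hft x'))) (Eventually.of_forall fun n => ?_)
    rw [← ofReal_integral_eq_lintegral_ofReal (h1 n) (ae_of_all _ (hf0 n)), ← h2 n]
    exact ENNReal.ofReal_le_ofReal (h3 n)
  have hkm : AEStronglyMeasurable[m] k μ := by
    refine ⟨fun x => limUnder atTop fun n => e n x,
      @StronglyMeasurable.limUnder _ _ _ m _ _ _ _ _ _ _ fun n => stronglyMeasurable_condExp, ?_⟩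
    filter_upwards [hek] with x hx using hx.limUnder_eq.symm
  have hki : Integrable k μ := by
    refine (integrable_cip (m := m) h h).mono' (hkm.mono hm) ?_
    filter_upwards [hek, ae_all_iff.2 hele, ae_all_iff.2 he0] with x h1 h2 h3
    rw [Real.norm_of_nonneg (ge_of_tendsto' h1 h3)]
    exact le_of_tendsto' h1 h2
  have hkey : cip m μ h h =ᵐ[μ] k := by
    refine (tendsto_condExp_unique f e (fun x => h x * h x) k hfi (fun n => integrable_condExp)
      (ae_of_all _ hft) hek (fun x => h x * h x) (integrable_coe_mul h h) (cip m μ h h)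
      (integrable_cip h h) (fun n => ae_of_all _ fun x => ?_) (fun n => ?_) fun n => ?_).trans
      (condExp_of_aestronglyMeasurable' hm hkm hki)
    · rw [Real.norm_of_nonneg (hf0 n x)]
      exact hfh n x
    · filter_upwards [hele n, he0 n] with x h1 h2
      rwa [Real.norm_of_nonneg h2]
    · rw [condExp_of_stronglyMeasurable hm stronglyMeasurable_condExp integrable_condExp]
  filter_upwards [hkey] with x hx
  rw [condFiberNorm_eq hmπ, hx, fiberNorm]
  simp only [k, pow_two]

end Disintegration

lemma almostPeriodic_congr {G : Type*} [Group G] [MeasurableSpace G] {X : Type*}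
    [MeasurableSpace X] [MulAction G X] {μ : Measure X} [IsSystem G X μ] {Y : Type*}
    [MeasurableSpace Y] {ν : Measure Y} {π : X → Y} (Γ : Subgroup G) {N N' : Lp ℝ 2 μ → X → ℝ}
    (h : ∀ u, N u =ᵐ[μ] N' u) : almostPeriodic Γ μ ν π N = almostPeriodic Γ μ ν π N' := by
  have key : ∀ {N N' : Lp ℝ 2 μ → X → ℝ}, (∀ u, N u =ᵐ[μ] N' u) → ∀ f,
      IsAlmostPeriodic Γ μ ν π N f → IsAlmostPeriodic Γ μ ν π N' f := by
    intro N N' h f hf ε hε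
    obtain ⟨Ξ, hΞ, E, hE, hνE, hAP⟩ := hf ε hε
    refine ⟨Ξ, hΞ, E, hE, hνE, fun γ hγ => ?_⟩
    filter_upwards [hAP γ hγ, (ae_ball_iff Ξ.countable_toSet).2
      fun ξ (_ : ξ ∈ Ξ) => h (koopman μ γ f - ξ)] with x h1 h2 hx
    obtain ⟨ξ, hξ, h3⟩ := h1 hx
    exact ⟨ξ, hξ, (h2 ξ hξ).symm.le.trans h3⟩
  exact congrArg closure (Set.ext fun f => ⟨key h f, key (fun u => (h u).symm) f⟩)

end RelErgodic

theorem mainTheorem6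
    {G : Type*} [Group G] [TopologicalSpace G] [IsTopologicalGroup G] [T2Space G]
    [LocallyCompactSpace G] [SecondCountableTopology G] [MeasurableSpace G] [BorelSpace G]
    (hG : RelErgodic.IsAmenable G)
    (Γ : Subgroup G) (hΓc : (Γ : Set G).Countable) (hΓd : Dense (Γ : Set G))
    {X : Type*} [MeasurableSpace X] [MulAction G X] (μ : Measure X) [RelErgodic.IsSystem G X μ]
    {Y : Type*} [MeasurableSpace Y] [MulAction G Y] (ν : Measure Y) [RelErgodic.IsSystem G Y ν]
    (π : X → Y) (hπ : RelErgodic.IsFactorMap G μ ν π) :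
    RelErgodic.almostPeriodic Γ μ ν π (RelErgodic.condFiberNorm μ π) =
        (RelErgodic.eigenspan G μ ν π : Set (Lp ℝ 2 μ)) ∧
      ∀ μy : Y → Measure X, RelErgodic.IsDisintegration G μ ν π μy →
        RelErgodic.almostPeriodic Γ μ ν π (RelErgodic.fiberNorm μ π μy) =
          (RelErgodic.eigenspan G μ ν π : Set (Lp ℝ 2 μ)) := by
  have : IsProbabilityMeasure μ := RelErgodic.IsSystem.isProbabilityMeasure G
  have : IsProbabilityMeasure ν := RelErgodic.IsSystem.isProbabilityMeasure G
  have main : RelErgodic.almostPeriodic Γ μ ν π (RelErgodic.condFiberNorm μ π) =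
      (RelErgodic.eigenspan G μ ν π : Set (Lp ℝ 2 μ)) := by
    refine Set.Subset.antisymm (closure_minimal
      (fun f hf => RelErgodic.IsAlmostPeriodic.mem_eigenspan rfl hG hΓd hπ hf)
      (Submodule.isClosed_topologicalClosure _)) ?_
    have h : RelErgodic.eigenspan G μ ν π ≤
        (RelErgodic.apSubmodule Γ μ ν π).topologicalClosure :=
      Submodule.topologicalClosure_minimal _ (Submodule.span_le.2 fun f hf =>
        RelErgodic.IsEigenfunction.mem_closure rfl hπ Γ hf)
        (Submodule.isClosed_topologicalClosure _)
    exact h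
  refine ⟨main, fun μy hd => ?_⟩
  rw [← main]
  exact RelErgodic.almostPeriodic_congr Γ fun u =>
    hd.ae_eq_condFiberNorm rfl hπ.measurePreserving u
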